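/- Let $A$ be a unital $C^*$-algebra and let $(A,E,\varphi)$ be a unital $C^*$-correspondence: $E$ is a right Hilbert $A$-module with $A$-valued inner product $\langle\cdot\mid\cdot\rangle$ (linear in the second variable), and $\varphi:A\to B(E)$ is a unital $*$-homomorphism into the adjointable operators on $E$. Write $K(E)\subseteq B(E)$ for the closed linear span of the operators $|e\rangle\langle f|: g\mapsto e\langle f\mid g\rangle$, and define the ideals of $A$ $$J_E=\{a\in A : \varphi(a)\in K(E)\ \text{and}\ a\ker(\varphi)=\ker(\varphi)a=0\},$$ $$I_0=A,\qquad I_1=\overline{\mathrm{span}}\{\langle e\mid f\rangle : e,f\in E\},\qquad I_{n+1}=\overline{\mathrm{span}}\{\langle e\mid\varphi(x)f\rangle : e,f\in E,\ x\in I_n\}\quad(n\ge 1).$$ Let $\mathcal T_E$ be the $C^*$-algebra generated by $A$ and the creation operators $T_e$ ($e\in E$) on the Fock module $\mathcal F(E)=A\oplus E\oplus E^{\otimes 2}\oplus\cdots$, let $\psi_1:K(E)\to\mathcal T_E$ be the continuous linear map with $\psi_1(|e\rangle\langle f|)=T_eT_f^*$, and let the Cuntz--Pimsner algebra $\mathcal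 O_E$ be the quotient of $\mathcal T_E$ by the closed two-sided ideal generated by the elements $a-\psi_1(\varphi(a))$, $a\in J_E$. The gauge action of the circle $\mathbb S^1$ on $\mathcal O_E$ fixes the image of $A$ and scales the image of each $T_e$ by $z\in\mathbb S^1$; for $k\ge 1$ it restricts to an action of $\mathbb Z/k\subset\mathbb S^1$, the group of $k$-th roots of unity. An action $\alpha$ of a finite group $G$ on a unital $C^*$-algebra $B$ is called free if the linear span of the functions $g\mapsto a\,\alpha_g(b)$, $a,b\in B$, is norm-dense in $B\otimes C(G)$, the algebra of all functions $G\to B$. Then for every integer $k\ge 2$ the gauge action of $\mathbb Z/k$ on $\mathcal O_E$ is free if and only if $$\overline{J_E+I_{k-1}}=A.$$ -/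

import Mathlib

/-- The `A`-valued inner product of a right Hilbert `A`-module `E`, linear in the second variable.
A right `A`-module is a module over `Aᵐᵒᵖ`, so that Mathlib's inner product takes its values there;
`rightInner` is the same element read in `A`. It satisfies `⟨x, y a⟩ = ⟨x, y⟩ a`. -/
def rightInner (A : Type*) {E : Type*} [Inner Aᵐᵒᵖ E] (x y : E) : A :=
  MulOpposite.unop (inner Aᵐᵒᵖ x y)

/-- A unital C⋆-correspondence over a unital C⋆-algebra `A` on the right Hilbert `A`-module `E`:
a unital ⋆-homomorphism `φ` from `A` to the adjointable operators on `E`. The field `inner_φ` says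
that `φ a` is adjointable with adjoint `φ (star a)`. -/
structure CStarCorrespondence (A E : Type*) [CStarAlgebra A] [PartialOrder A] [StarOrderedRing A]
    [NormedAddCommGroup E] [NormedSpace ℂ E] [Module Aᵐᵒᵖ E] [CStarModule Aᵐᵒᵖ E] where
  φ : A →ₐ[ℂ] (E →L[ℂ] E)
  inner_φ : ∀ (a : A) (x y : E), rightInner A (φ a x) y = rightInner A x (φ (star a) y)

namespace CStarCorrespondence

set_option linter.unusedSectionVars false

section RightInner

variable {A E : Type*} [CStarAlgebra A] [PartialOrder A] [StarOrderedRing A]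
  [NormedAddCommGroup E] [NormedSpace ℂ E] [Module Aᵐᵒᵖ E] [CStarModule Aᵐᵒᵖ E]

theorem rightInner_add_right (x y z : E) :
    rightInner A x (y + z) = rightInner A x y + rightInner A x z := by
  simp [rightInner]

theorem rightInner_add_left (x y z : E) :
    rightInner A (x + y) z = rightInner A x z + rightInner A y z := by
  simp [rightInner]

theorem rightInner_smul_right (c : ℂ) (x y : E) :
    rightInner A x (c • y) = c • rightInner A x y := by
  simp [rightInner]

theorem rightInner_smul_left (c : ℂ) (x y : E) :
    rightInner A (c • x) y = star c • rightInner A x y := by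
  simp only [rightInner, CStarModule.inner_smul_left_complex, MulOpposite.unop_smul]

theorem rightInner_op_smul_right (a : A) (x y : E) :
    rightInner A x (MulOpposite.op a • y) = rightInner A x y * a := by
  simp [rightInner]

theorem rightInner_op_smul_left (a : A) (x y : E) :
    rightInner A (MulOpposite.op a • x) y = star a * rightInner A x y := by
  simp [rightInner]

theorem star_rightInner (x y : E) : star (rightInner A x y) = rightInner A y x := by
  rw [rightInner, ← MulOpposite.unop_star, CStarModule.star_inner, rightInner]

theorem rightInner_self_nonneg (x : E) : 0 ≤ rightInner A x x := by
  have h : (0 : Aᵐᵒᵖ) ≤ inner Aᵐᵒᵖ x x := CStarModule.inner_self_nonneg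
  exact h

theorem rightInner_zero_right (x : E) : rightInner A x 0 = 0 := by
  simp [rightInner]

theorem rightInner_zero_left (x : E) : rightInner A 0 x = 0 := by
  simp [rightInner]

theorem rightInner_sum_right {ι : Type*} (s : Finset ι) (x : E) (y : ι → E) :
    rightInner A x (∑ i ∈ s, y i) = ∑ i ∈ s, rightInner A x (y i) := by
  simp [rightInner]

theorem rightInner_sum_left {ι : Type*} (s : Finset ι) (x : ι → E) (y : E) :
    rightInner A (∑ i ∈ s, x i) y = ∑ i ∈ s, rightInner A (x i) y := by
  simp [rightInner]

theorem norm_rightInner_le (x y : E) : ‖rightInner A x y‖ ≤ ‖x‖ * ‖y‖ := by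
  have h : ‖inner Aᵐᵒᵖ x y‖ ≤ ‖x‖ * ‖y‖ := CStarModule.norm_inner_le E
  exact h

theorem norm_rightInner_self (x : E) : ‖rightInner A x x‖ = ‖x‖ ^ 2 :=
  (CStarModule.norm_sq_eq Aᵐᵒᵖ).symm

theorem ext_rightInner {x y : E} (h : ∀ z : E, rightInner A z x = rightInner A z y) : x = y := by
  rw [← sub_eq_zero, ← norm_eq_zero, ← sq_eq_zero_iff, ← norm_rightInner_self (A := A),
    sub_eq_add_neg, rightInner_add_right, h, ← rightInner_add_right]
  simp [rightInner_zero_right]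

theorem norm_op_smul_le (a : A) (x : E) : ‖MulOpposite.op a • x‖ ≤ ‖a‖ * ‖x‖ := by
  refine le_of_sq_le_sq ?_ (by positivity)
  rw [← norm_rightInner_self (A := A), rightInner_op_smul_right, rightInner_op_smul_left]
  calc ‖star a * rightInner A x x * a‖ ≤ ‖star a‖ * ‖rightInner A x x‖ * ‖a‖ := by
        exact (norm_mul_le _ _).trans (by gcongr; exact norm_mul_le _ _)
    _ = (‖a‖ * ‖x‖) ^ 2 := by rw [norm_star, norm_rightInner_self]; ring

end RightInner

section PosKernel

/-- Positive and negative parts of a self-adjoint element, in the form used for `PosKernel`. -/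
theorem exists_factor {B : Type*} [CStarAlgebra B] {M : B} (hM : IsSelfAdjoint M) :
    ∃ S N R : B, star N = N ∧ N * M * N = -(star R * R) ∧ (R = 0 → M = star S * S) := by
  let _ := CStarAlgebra.spectralOrder B
  have _ := CStarAlgebra.spectralOrderedRing B
  obtain ⟨S, hS⟩ := CStarAlgebra.nonneg_iff_eq_star_mul_self.mp (CFC.posPart_nonneg M)
  obtain ⟨Q, hQ⟩ := CStarAlgebra.nonneg_iff_eq_star_mul_self.mp (CFC.negPart_nonneg M)
  have hN : star M⁻ = M⁻ := (IsSelfAdjoint.of_nonneg (CFC.negPart_nonneg M)).star_eq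
  have hPN := CFC.posPart_mul_negPart M
  have hsub := CFC.posPart_sub_negPart M hM
  have hR : star (Q * M⁻) * (Q * M⁻) = M⁻ * M⁻ * M⁻ := by
    calc star (Q * M⁻) * (Q * M⁻) = star M⁻ * (star Q * Q) * M⁻ := by
          rw [star_mul]; noncomm_ring
      _ = _ := by rw [← hQ, hN]
  refine ⟨S, M⁻, Q * M⁻, hN, ?_, fun h => ?_⟩
  · rw [hR]
    calc M⁻ * M * M⁻ = M⁻ * (M⁺ - M⁻) * M⁻ := by rw [hsub]
      _ = M⁻ * (M⁺ * M⁻) - M⁻ * M⁻ * M⁻ := by noncomm_ring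
      _ = _ := by rw [hPN]; simp
  · rw [h, mul_zero] at hR
    have h2 : M⁻ * M⁻ = 0 := by
      rw [← CStarRing.star_mul_self_eq_zero_iff, star_mul, hN, ← mul_assoc, ← hR, zero_mul]
    have h1 : M⁻ = 0 := by
      rw [← CStarRing.star_mul_self_eq_zero_iff, hN, h2]
    rw [← hS]
    simpa [h1] using hsub.symm

variable {A : Type*} [CStarAlgebra A] [PartialOrder A] [StarOrderedRing A]
  {ι : Type*} [Fintype ι]

/-- Positivity of a finite square matrix over `A`. -/
structure PosKernel (a : ι → ι → A) : Prop where
  star_eq : ∀ i j, star (a i j) = a j i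
  nonneg : ∀ x : ι → A, 0 ≤ ∑ i, ∑ j, star (x i) * a i j * x j

theorem PosKernel.add {a b : ι → ι → A} (ha : PosKernel a) (hb : PosKernel b) :
    PosKernel fun i j => a i j + b i j where
  star_eq i j := by simp [ha.star_eq, hb.star_eq]
  nonneg x := by
    simpa [mul_add, add_mul, Finset.sum_add_distrib] using add_nonneg (ha.nonneg x) (hb.nonneg x)

theorem PosKernel.restrict {a : ι → ι → A} (ha : PosKernel a) (p : ι → Prop) [DecidablePred p] :
    PosKernel fun i j => if p i ∧ p j then a i j else 0 where
  star_eq i j := by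
    by_cases hi : p i <;> by_cases hj : p j <;> simp [hi, hj, ha.star_eq]
  nonneg x := by
    refine (ha.nonneg fun i => if p i then x i else 0).trans_eq ?_
    refine Finset.sum_congr rfl fun i _ => Finset.sum_congr rfl fun j _ => ?_
    by_cases hi : p i <;> by_cases hj : p j <;> simp [hi, hj]

theorem PosKernel.const {c : A} (hc : 0 ≤ c) : PosKernel fun _ _ : ι => c where
  star_eq _ _ := (IsSelfAdjoint.of_nonneg hc).star_eq
  nonneg x := by
    have h : ∑ i, ∑ j, star (x i) * c * x j = star (∑ i, x i) * c * ∑ j, x j := by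
      simp only [star_sum, Finset.sum_mul, Finset.mul_sum]
      exact Finset.sum_comm
    rw [h]
    exact star_left_conjugate_nonneg hc _

theorem PosKernel.factor {a : ι → ι → A} (ha : PosKernel a) :
    ∃ s : ι → ι → A, ∀ i j, a i j = ∑ k, star (s k i) * s k j := by
  classical
  let M : CStarMatrix ι ι A := CStarMatrix.ofMatrix (Matrix.of a)
  have hM : IsSelfAdjoint M := by
    ext i j
    exact ha.star_eq j i
  obtain ⟨S, N, R, hN, hR, hS⟩ := exists_factor hM
  have happ : ∀ (X Y : CStarMatrix ι ι A) (i j : ι), (X * Y) i j = ∑ k, X i k * Y k j :=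
    fun X Y i j => CStarMatrix.mul_apply
  have hdiag : ∀ l, ∑ k, star (R k l) * R k l = 0 := by
    intro l
    refine le_antisymm ?_ (Finset.sum_nonneg fun k _ => star_mul_self_nonneg _)
    have h1 := congrFun (congrFun hR l) l
    have h2 : (N * M * N) l l = ∑ i, ∑ j, star (N i l) * a i j * N j l := by
      rw [happ]
      simp only [happ, Finset.sum_mul]
      rw [Finset.sum_comm]
      refine Finset.sum_congr rfl fun i _ => Finset.sum_congr rfl fun j _ => ?_
      have h3 : N l i = star (N i l) := (congrFun (congrFun hN l) i).symm
      rw [h3]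
      rfl
    have h4 : (-(star R * R) : CStarMatrix ι ι A) l l = -∑ k, star (R k l) * R k l :=
      congrArg Neg.neg (happ (star R) R l l)
    rw [h2, h4] at h1
    have h5 := ha.nonneg fun i => N i l
    rw [h1] at h5
    exact neg_nonneg.mp h5
  have hR0 : R = 0 := by
    ext k l
    have h := (Finset.sum_eq_zero_iff_of_nonneg
      (fun k _ => star_mul_self_nonneg (R k l))).mp (hdiag l) k (Finset.mem_univ k)
    exact CStarRing.star_mul_self_eq_zero_iff _ |>.mp h
  refine ⟨fun k i => S k i, fun i j => ?_⟩
  exact (congrFun (congrFun (hS hR0) i) j).trans (happ (star S) S i j)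

end PosKernel

section Fock

variable {A E : Type*} [CStarAlgebra A] [PartialOrder A] [StarOrderedRing A]
  [NormedAddCommGroup E] [NormedSpace ℂ E] [Module Aᵐᵒᵖ E] [CStarModule Aᵐᵒᵖ E]
  (X : CStarCorrespondence A E)

theorem PosKernel.inner_φ {ι : Type*} [Fintype ι] {a : ι → ι → A} (ha : PosKernel a) (e : ι → E) :
    PosKernel fun i j => rightInner A (e i) (X.φ (a i j) (e j)) where
  star_eq i j := by
    rw [star_rightInner, X.inner_φ, ha.star_eq]
  nonneg x := by
    obtain ⟨s, hs⟩ := ha.factor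
    have h : ∑ i, ∑ j, star (x i) * rightInner A (e i) (X.φ (a i j) (e j)) * x j =
        ∑ k, rightInner A (∑ i, MulOpposite.op (x i) • X.φ (s k i) (e i))
          (∑ j, MulOpposite.op (x j) • X.φ (s k j) (e j)) := by
      have h1 : ∀ i j, star (x i) * rightInner A (e i) (X.φ (a i j) (e j)) * x j =
          ∑ k, rightInner A (MulOpposite.op (x i) • X.φ (s k i) (e i))
            (MulOpposite.op (x j) • X.φ (s k j) (e j)) := by
        intro i j
        simp only [rightInner_op_smul_left, rightInner_op_smul_right, X.inner_φ]
        rw [hs, map_sum, sum_apply, rightInner_sum_right, Finset.mul_sum, Finset.sum_mul]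
        refine Finset.sum_congr rfl fun k _ => ?_
        rw [map_mul, mul_apply_eq_comp]
      simp only [h1, rightInner_sum_left, rightInner_sum_right]
      rw [Finset.sum_congr rfl fun i _ => Finset.sum_comm, Finset.sum_comm]
      exact Finset.sum_congr rfl fun k _ => Finset.sum_comm
    rw [h]
    exact Finset.sum_nonneg fun k _ => rightInner_self_nonneg _

/-- For words `w = [e₁, …, eₙ]` and `v = [f₁, …, fₘ]` in `E`, this is the inner product
`⟨e₁ ⊗ ⋯ ⊗ eₙ, φ(a) (f₁ ⊗ ⋯ ⊗ fₘ)⟩` of the Fock module: zero for `n ≠ m`, and for `n = m`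
determined by `⟨e ⊗ ξ, φ(a) (f ⊗ η)⟩ = ⟨ξ, φ(⟨e, φ(a) f⟩) η⟩`. The empty word stands for the unit
of the summand `A` of the Fock module. -/
def wordInner : A → List E → List E → A
  | a, [], [] => a
  | a, e :: w, f :: v => wordInner (rightInner A e (X.φ a f)) w v
  | _, [], _ :: _ => 0
  | _, _ :: _, [] => 0

theorem wordInner_add (a b : A) (w v : List E) :
    X.wordInner (a + b) w v = X.wordInner a w v + X.wordInner b w v := by
  induction w generalizing a b v with
  | nil => cases v <;> simp [wordInner]
  | cons e w ih => cases v <;> simp [wordInner, rightInner_add_right, ih]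

theorem wordInner_smul (c : ℂ) (a : A) (w v : List E) :
    X.wordInner (c • a) w v = c • X.wordInner a w v := by
  induction w generalizing a v with
  | nil => cases v <;> simp [wordInner]
  | cons e w ih => cases v <;> simp [wordInner, rightInner_smul_right, ih]

theorem wordInner_star (a : A) (w v : List E) :
    star (X.wordInner a w v) = X.wordInner (star a) v w := by
  induction w generalizing a v with
  | nil => cases v <;> simp [wordInner]
  | cons e w ih => cases v <;> simp [wordInner, ih, star_rightInner, X.inner_φ]

theorem wordInner_of_length_ne (a : A) (w v : List E) (h : w.length ≠ v.length) :
    X.wordInner a w v = 0 := by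
  induction w generalizing a v with
  | nil => cases v <;> simp_all [wordInner]
  | cons e w ih => cases v <;> simp_all [wordInner]

theorem PosKernel.wordInner {ι : Type*} [Fintype ι] {a : ι → ι → A} (ha : PosKernel a)
    (w : ι → List E) : PosKernel fun i j => X.wordInner (a i j) (w i) (w j) := by
  obtain ⟨n, hn⟩ : ∃ n, ∀ i, (w i).length ≤ n :=
    ⟨Finset.univ.sup fun i => (w i).length, fun i =>
      Finset.le_sup (f := fun i => (w i).length) (Finset.mem_univ i)⟩
  induction n generalizing a w with
  | zero =>
    have h : ∀ i, w i = [] := fun i => List.length_eq_zero_iff.mp (Nat.le_zero.mp (hn i))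
    simpa [h, CStarCorrespondence.wordInner] using ha
  | succ n ih =>
    classical
    have h1 := ih (ha.inner_φ X fun i => (w i).headD 0) (fun i => (w i).tail)
      (fun i => by simpa using hn i)
    have h2 := (ha.restrict fun i => w i = []).add (h1.restrict fun i => w i ≠ [])
    convert h2 using 3 with i j
    rcases w i with _ | ⟨e, u⟩ <;> rcases w j with _ | ⟨f, v⟩ <;>
      simp [CStarCorrespondence.wordInner]

/-- The algebraic Fock module: the free right `A`-module on the words in `E`, where `single w a`
stands for `e₁ ⊗ ⋯ ⊗ eₙ a` in `E^{⊗ n}` (and for `a` in `A` if the word is empty). All relations of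
the balanced tensor products hold up to vectors of norm zero. -/
@[nolint unusedArguments]
def PreFock (_ : CStarCorrespondence A E) : Type _ := List E →₀ A

noncomputable instance : AddCommGroup X.PreFock := inferInstanceAs (AddCommGroup (List E →₀ A))

noncomputable instance : Module ℂ X.PreFock := inferInstanceAs (Module ℂ (List E →₀ A))

/-- The element `e₁ ⊗ ⋯ ⊗ eₙ a`, linear in `a`. -/
noncomputable def word (w : List E) : A →ₗ[ℂ] X.PreFock := Finsupp.lsingle w

/-- Linear maps out of the algebraic Fock module. -/
noncomputable def wordLift {V : Type*} [AddCommGroup V] [Module ℂ V] (f : List E → A →ₗ[ℂ] V) :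
    X.PreFock →ₗ[ℂ] V := Finsupp.lsum ℂ f

theorem wordLift_word {V : Type*} [AddCommGroup V] [Module ℂ V] (f : List E → A →ₗ[ℂ] V)
    (w : List E) (x : A) : X.wordLift f (X.word w x) = f w x :=
  Finsupp.lsum_single ℂ f w x

theorem word_induction {p : X.PreFock → Prop} (h0 : p 0)
    (h : ∀ w x ξ, p ξ → p (X.word w x + ξ)) (ξ : X.PreFock) : p ξ :=
  Finsupp.induction ξ h0 fun w x ξ _ _ hξ => h w x ξ hξ

theorem preFock_hom_ext {V : Type*} [AddCommGroup V] [Module ℂ V] {f g : X.PreFock →ₗ[ℂ] V}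
    (h : ∀ w x, f (X.word w x) = g (X.word w x)) : f = g :=
  LinearMap.ext fun ξ => X.word_induction (p := fun ξ => f ξ = g ξ) (by rw [map_zero, map_zero])
    (fun w x ξ hξ => by rw [map_add, map_add, h, hξ]) ξ

theorem preFock_eq_sum (ξ : X.PreFock) :
    ∃ (s : Finset (List E)) (x : List E → A), ξ = ∑ w ∈ s, X.word w (x w) :=
  ⟨Finsupp.support ξ, fun w => (show List E →₀ A from ξ) w, (Finsupp.sum_single ξ).symm⟩

/-- The `A`-valued form `⟨ξ, φ(c) η⟩` on the algebraic Fock module, conjugate linear in `ξ` and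
linear in `η`, with `⟨w x, φ(c) (v y)⟩ = x⋆ ⟨w, φ(c) v⟩ y` for words `w`, `v` and `x`, `y` in `A`. -/
noncomputable def preInner (c : A) : X.PreFock →ₗ⋆[ℂ] X.PreFock →ₗ[ℂ] A where
  toFun ξ := Finsupp.sum (show List E →₀ A from ξ) fun w x =>
    X.wordLift fun v => LinearMap.mulLeft ℂ (star x * X.wordInner c w v)
  map_add' ξ η := by
    refine Finsupp.sum_add_index' (fun w => ?_) fun w x y => ?_ <;>
    refine X.preFock_hom_ext fun v z => ?_
    · simp [wordLift_word]
    · simp [wordLift_word, add_mul, mul_assoc]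
  map_smul' r ξ := by
    refine (Finsupp.sum_smul_index' fun w => ?_).trans ?_
    · refine X.preFock_hom_ext fun v z => ?_
      simp [wordLift_word]
    · rw [Finsupp.smul_sum]
      refine Finsupp.sum_congr fun w _ => X.preFock_hom_ext fun v z => ?_
      simp [wordLift_word, mul_assoc]

theorem preInner_word (c : A) (w v : List E) (x y : A) :
    X.preInner c (X.word w x) (X.word v y) = star x * X.wordInner c w v * y := by
  have h : X.preInner c (X.word w x) =
      X.wordLift fun v => LinearMap.mulLeft ℂ (star x * X.wordInner c w v) := by
    refine Finsupp.sum_single_index (h := fun (w : List E) (x : A) =>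
      X.wordLift fun v => LinearMap.mulLeft ℂ (star x * X.wordInner c w v)) ?_
    refine X.preFock_hom_ext fun v z => ?_
    simp [wordLift_word]
  rw [h, wordLift_word, LinearMap.mulLeft_apply]

theorem preInner_ext {p q : X.PreFock →ₗ⋆[ℂ] X.PreFock →ₗ[ℂ] A}
    (h : ∀ w x v y, p (X.word w x) (X.word v y) = q (X.word w x) (X.word v y)) : p = q := by
  refine LinearMap.ext fun ξ => X.word_induction (p := fun ξ => p ξ = q ξ)
    (by rw [map_zero, map_zero]) (fun w x ξ hξ => ?_) ξ
  rw [map_add, map_add, hξ, X.preFock_hom_ext fun v y => h w x v y]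

theorem preInner_add (c d : A) (ξ η : X.PreFock) :
    X.preInner (c + d) ξ η = X.preInner c ξ η + X.preInner d ξ η := by
  have h : X.preInner (c + d) = X.preInner c + X.preInner d := X.preInner_ext fun w x v y => by
    simp [preInner_word, wordInner_add, mul_add, add_mul]
  rw [h]; rfl

theorem preInner_smul (r : ℂ) (c : A) (ξ η : X.PreFock) :
    X.preInner (r • c) ξ η = r • X.preInner c ξ η := by
  have h : X.preInner (r • c) = r • X.preInner c := X.preInner_ext fun w x v y => by
    simp [preInner_word, wordInner_smul]
  rw [h]; rfl

theorem star_preInner (c : A) (ξ η : X.PreFock) :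
    star (X.preInner c ξ η) = X.preInner (star c) η ξ := by
  refine X.word_induction (p := fun ξ => star (X.preInner c ξ η) = X.preInner (star c) η ξ)
    (by simp) (fun w x ξ hξ => ?_) ξ
  rw [map_add, map_add, LinearMap.add_apply, star_add, hξ]
  congr 1
  refine X.word_induction
    (p := fun η => star (X.preInner c (X.word w x) η) = X.preInner (star c) η (X.word w x))
    (by simp) (fun v y η hη => ?_) η
  rw [map_add, map_add, LinearMap.add_apply, star_add, hη, preInner_word, preInner_word]
  simp [wordInner_star, mul_assoc]

theorem preInner_self_nonneg {c : A} (hc : 0 ≤ c) (ξ : X.PreFock) : 0 ≤ X.preInner c ξ ξ := by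
  obtain ⟨s, x, rfl⟩ := X.preFock_eq_sum ξ
  have h := ((PosKernel.const (ι := s) hc).wordInner X fun w => w.1).nonneg fun w => x w
  have h2 : X.preInner c (∑ w ∈ s, X.word w (x w)) (∑ w ∈ s, X.word w (x w)) =
      ∑ w ∈ s, ∑ v ∈ s, star (x w) * X.wordInner c w v * x v := by
    simp only [map_sum, LinearMap.sum_apply, preInner_word]
    exact Finset.sum_comm
  rw [h2, ← Finset.sum_coe_sort]
  refine h.trans_eq (Finset.sum_congr rfl fun w _ => ?_)
  exact Finset.sum_coe_sort s fun v => star (x w) * X.wordInner c w v * x v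


theorem preInner_self_le {c : A} (hc : 0 ≤ c) (ξ : X.PreFock) :
    X.preInner c ξ ξ ≤ ‖c‖ • X.preInner 1 ξ ξ := by
  have h : 0 ≤ (‖c‖ : ℂ) • (1 : A) + (-1 : ℂ) • c := by
    have h1 := (IsSelfAdjoint.of_nonneg hc).le_algebraMap_norm_self
    rw [Algebra.algebraMap_eq_smul_one] at h1
    simpa [← sub_eq_add_neg] using h1
  have h2 := X.preInner_self_nonneg h ξ
  rw [preInner_add, preInner_smul, preInner_smul] at h2
  simpa [← sub_eq_add_neg] using h2

/-- Right multiplication by `b` on the algebraic Fock module. -/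
noncomputable def preRight (b : A) : X.PreFock →ₗ[ℂ] X.PreFock :=
  X.wordLift fun w => X.word w ∘ₗ LinearMap.mulRight ℂ b

theorem preInner_preRight (c b : A) (ξ η : X.PreFock) :
    X.preInner c ξ (X.preRight b η) = X.preInner c ξ η * b := by
  have h : (X.preInner c).compl₂ (X.preRight b) =
      (X.preInner c).compr₂ₛₗ (LinearMap.mulRight ℂ b) := X.preInner_ext fun w x v y => by
    simp [preRight, wordLift_word, preInner_word, mul_assoc]
  exact congrArg (fun f => f ξ η) h

theorem preInner_preRight_left (c b : A) (ξ η : X.PreFock) :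
    X.preInner c (X.preRight b ξ) η = star b * X.preInner c ξ η := by
  rw [← star_star c, ← star_preInner, preInner_preRight, star_mul, star_preInner]

theorem norm_preInner_sq_le (ξ η : X.PreFock) :
    ‖X.preInner 1 ξ η‖ ^ 2 ≤ ‖X.preInner 1 ξ ξ‖ * ‖X.preInner 1 η η‖ := by
  have key : ∀ ε : ℝ, 0 < ε →
      ‖X.preInner 1 ξ η‖ ^ 2 ≤ (‖X.preInner 1 ξ ξ‖ + ε) * ‖X.preInner 1 η η‖ := by
    intro ε hε
    set b := X.preInner 1 ξ η with hb
    set N := ‖X.preInner 1 ξ ξ‖ with hN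
    have hN0 : 0 ≤ N := norm_nonneg _
    set t : ℝ := (N + ε)⁻¹ with ht
    have ht0 : 0 < t := by positivity
    have htN : t * N ≤ 1 := by
      rw [ht, inv_mul_le_iff₀ (by positivity)]
      linarith
    have hb' : X.preInner 1 η ξ = star b := by rw [hb, star_preInner, star_one]
    have h0 := X.preInner_self_nonneg zero_le_one (η - (t : ℂ) • X.preRight b ξ)
    have h1 : X.preInner 1 (η - (t : ℂ) • X.preRight b ξ) (η - (t : ℂ) • X.preRight b ξ) =
        X.preInner 1 η η - (2 * t) • (star b * b) + (t ^ 2) • (star b * X.preInner 1 ξ ξ * b) := by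
      simp only [map_sub, LinearMap.sub_apply, map_smul, LinearMap.map_smulₛₗ, LinearMap.smul_apply,
        preInner_preRight, preInner_preRight_left, hb', ← hb, Complex.conj_ofReal]
      simp only [Complex.coe_smul, smul_sub, smul_smul, two_mul, add_smul, pow_two, mul_assoc]
      abel
    have h2 : star b * X.preInner 1 ξ ξ * b ≤ N • (star b * b) :=
      CStarAlgebra.star_left_conjugate_le_norm_smul
        (IsSelfAdjoint.of_nonneg (X.preInner_self_nonneg zero_le_one ξ))
    have h3 : t • (star b * b) ≤ X.preInner 1 η η := by
      have h4 : (t ^ 2) • (star b * X.preInner 1 ξ ξ * b) ≤ t • (star b * b) := by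
        calc (t ^ 2) • (star b * X.preInner 1 ξ ξ * b) ≤ (t ^ 2) • (N • (star b * b)) := by
              gcongr
          _ = (t * (t * N)) • (star b * b) := by rw [smul_smul]; congr 1; ring
          _ ≤ t • (star b * b) := by
              refine smul_le_smul_of_nonneg_right ?_ (star_mul_self_nonneg b)
              nlinarith
      rw [h1] at h0
      have h5 := h0.trans (add_le_add_right h4 _)
      have h6 : X.preInner 1 η η - (2 * t) • (star b * b) + t • (star b * b) =
          X.preInner 1 η η - t • (star b * b) := by
        rw [two_mul, add_smul]; abel
      rw [h6] at h5
      exact sub_nonneg.mp h5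
    have h7 := CStarAlgebra.norm_le_norm_of_nonneg_of_le
      (smul_nonneg ht0.le (star_mul_self_nonneg b)) h3
    rw [norm_smul, CStarRing.norm_star_mul_self, Real.norm_of_nonneg ht0.le, ht,
      inv_mul_le_iff₀ (by positivity)] at h7
    rw [pow_two]
    exact h7
  have hc : Filter.Tendsto (fun ε : ℝ => (‖X.preInner 1 ξ ξ‖ + ε) * ‖X.preInner 1 η η‖)
      (nhdsWithin 0 (Set.Ioi 0)) (nhds ((‖X.preInner 1 ξ ξ‖ + 0) * ‖X.preInner 1 η η‖)) :=
    (Continuous.tendsto (by fun_prop) 0).mono_left nhdsWithin_le_nhds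
  rw [add_zero] at hc
  exact ge_of_tendsto hc (Filter.eventually_of_mem self_mem_nhdsWithin fun ε hε => key ε hε)

/-- The seminorm `‖ξ‖ = ‖⟨ξ, ξ⟩‖^{1/2}` of the algebraic Fock module. -/
noncomputable instance : SeminormedAddCommGroup X.PreFock :=
  AddGroupSeminorm.toSeminormedAddCommGroup
    { toFun := fun ξ => √‖X.preInner 1 ξ ξ‖
      map_zero' := by simp
      add_le' := fun ξ η => by
        refine Real.sqrt_le_iff.mpr ⟨by positivity, ?_⟩
        have h1 : ‖X.preInner 1 ξ η‖ ≤ √‖X.preInner 1 ξ ξ‖ * √‖X.preInner 1 η η‖ := by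
          rw [← Real.sqrt_mul (norm_nonneg _)]
          exact Real.le_sqrt_of_sq_le (X.norm_preInner_sq_le ξ η)
        have h2 : ‖X.preInner 1 η ξ‖ = ‖X.preInner 1 ξ η‖ := by
          rw [← norm_star, star_preInner, star_one]
        have h3 := Real.sq_sqrt (norm_nonneg (X.preInner 1 ξ ξ))
        have h4 := Real.sq_sqrt (norm_nonneg (X.preInner 1 η η))
        simp only [map_add, LinearMap.add_apply]
        have h5 := norm_add₄_le (a := X.preInner 1 ξ ξ) (b := X.preInner 1 η ξ)
          (c := X.preInner 1 ξ η) (d := X.preInner 1 η η)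
        refine le_trans (le_of_eq ?_) (h5.trans ?_)
        · congr 1; abel
        · nlinarith
      neg' := fun ξ => by simp }

theorem norm_preFock_def (ξ : X.PreFock) : ‖ξ‖ = √‖X.preInner 1 ξ ξ‖ := rfl

theorem norm_preFock_sq (ξ : X.PreFock) : ‖ξ‖ ^ 2 = ‖X.preInner 1 ξ ξ‖ := by
  rw [norm_preFock_def, Real.sq_sqrt (norm_nonneg _)]

theorem norm_preInner_le (ξ η : X.PreFock) : ‖X.preInner 1 ξ η‖ ≤ ‖ξ‖ * ‖η‖ := by
  refine le_of_sq_le_sq ?_ (by positivity)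
  rw [mul_pow, norm_preFock_sq, norm_preFock_sq]
  exact X.norm_preInner_sq_le ξ η

noncomputable instance : NormedSpace ℂ X.PreFock where
  norm_smul_le r ξ := by
    refine le_of_sq_le_sq (le_of_eq ?_) (by positivity)
    rw [mul_pow, norm_preFock_sq, norm_preFock_sq]
    simp [norm_smul, pow_two, mul_assoc]

theorem norm_le_of_preInner_le {ξ η : X.PreFock} {C : ℝ} (hC : 0 ≤ C)
    (h : X.preInner 1 η η ≤ C ^ 2 • X.preInner 1 ξ ξ) : ‖η‖ ≤ C * ‖ξ‖ := by
  refine le_of_sq_le_sq ?_ (by positivity)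
  rw [mul_pow, norm_preFock_sq, norm_preFock_sq]
  refine (CStarAlgebra.norm_le_norm_of_nonneg_of_le
    (X.preInner_self_nonneg zero_le_one η) h).trans_eq ?_
  rw [norm_smul, Real.norm_of_nonneg (by positivity)]

/-- A linear map on the algebraic Fock module with a formal adjoint that is bounded. -/
theorem norm_le_of_adjoint {S T : X.PreFock →ₗ[ℂ] X.PreFock} {C : ℝ} (hC : 0 ≤ C)
    (hT : ∀ ξ, ‖T ξ‖ ≤ C * ‖ξ‖)
    (hST : ∀ ξ η, X.preInner 1 (T ξ) η = X.preInner 1 ξ (S η)) (η : X.PreFock) :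
    ‖S η‖ ≤ C * ‖η‖ := by
  rcases eq_or_lt_of_le (norm_nonneg (S η)) with h | h
  · rw [← h]; positivity
  · have h1 : ‖S η‖ * ‖S η‖ ≤ ‖S η‖ * (C * ‖η‖) := by
      rw [← pow_two, norm_preFock_sq, ← hST]
      calc ‖X.preInner 1 (T (S η)) η‖ ≤ ‖T (S η)‖ * ‖η‖ := X.norm_preInner_le _ _
        _ ≤ (C * ‖S η‖) * ‖η‖ := by gcongr; exact hT _
        _ = _ := by ring
    exact le_of_mul_le_mul_left h1 h

/-- The left action of `a` on the algebraic Fock module, through left multiplication on `A` and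
through `φ(a)` on the first tensor factor of the other summands. -/
noncomputable def preLeft (a : A) : X.PreFock →ₗ[ℂ] X.PreFock :=
  X.wordLift fun
    | [] => X.word [] ∘ₗ LinearMap.mulLeft ℂ a
    | e :: w => X.word (X.φ a e :: w)

/-- The creation operator `ξ ↦ e ⊗ ξ` on the algebraic Fock module. -/
noncomputable def preCreate (e : E) : X.PreFock →ₗ[ℂ] X.PreFock :=
  X.wordLift fun w => X.word (e :: w)

/-- The annihilation operator of `e` on the algebraic Fock module, which vanishes on `A` and sends
`f ⊗ ξ` to `φ(⟨e, f⟩) ξ`. -/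
noncomputable def preAnnihilate (e : E) : X.PreFock →ₗ[ℂ] X.PreFock :=
  X.wordLift fun
    | [] => 0
    | f :: w => X.preLeft (rightInner A e f) ∘ₗ X.word w

/-- The operator on the algebraic Fock module that scales the words of length `n` by `z ^ n`. -/
noncomputable def preGauge (z : Circle) : X.PreFock →ₗ[ℂ] X.PreFock :=
  X.wordLift fun w => (z : ℂ) ^ w.length • X.word w

theorem preLeft_nil (a x : A) : X.preLeft a (X.word [] x) = X.word [] (a * x) := by
  simp [preLeft, wordLift_word]

theorem preLeft_cons (a x : A) (e : E) (w : List E) :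
    X.preLeft a (X.word (e :: w) x) = X.word (X.φ a e :: w) x := by
  simp [preLeft, wordLift_word]

theorem preCreate_word (e : E) (w : List E) (x : A) :
    X.preCreate e (X.word w x) = X.word (e :: w) x := by
  simp [preCreate, wordLift_word]

theorem preAnnihilate_nil (e : E) (x : A) : X.preAnnihilate e (X.word [] x) = 0 := by
  simp [preAnnihilate, wordLift_word]

theorem preAnnihilate_cons (e f : E) (w : List E) (x : A) :
    X.preAnnihilate e (X.word (f :: w) x) = X.preLeft (rightInner A e f) (X.word w x) := by
  simp [preAnnihilate, wordLift_word]

theorem preGauge_word (z : Circle) (w : List E) (x : A) :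
    X.preGauge z (X.word w x) = (z : ℂ) ^ w.length • X.word w x := by
  simp [preGauge, wordLift_word]

theorem preInner_preLeft (c a : A) (ξ η : X.PreFock) :
    X.preInner c ξ (X.preLeft a η) = X.preInner (c * a) ξ η := by
  have h : (X.preInner c).compl₂ (X.preLeft a) = X.preInner (c * a) :=
    X.preInner_ext fun w x v y => by
      rcases v with _ | ⟨f, v⟩ <;> rcases w with _ | ⟨e, w⟩ <;>
      simp [preLeft_nil, preLeft_cons, preInner_word, wordInner, mul_assoc]
  exact congrArg (fun f => f ξ η) h

theorem preInner_preLeft_left (c a : A) (ξ η : X.PreFock) :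
    X.preInner c (X.preLeft a ξ) η = X.preInner (star a * c) ξ η := by
  rw [← star_star (X.preInner c _ _), star_preInner, preInner_preLeft, star_preInner]
  simp

theorem preInner_preCreate (c : A) (e f : E) (ξ η : X.PreFock) :
    X.preInner c (X.preCreate e ξ) (X.preCreate f η) =
      X.preInner (rightInner A e (X.φ c f)) ξ η := by
  have h : ((X.preInner c).comp (X.preCreate e)).compl₂ (X.preCreate f) =
      X.preInner (rightInner A e (X.φ c f)) := X.preInner_ext fun w x v y => by
    simp [preCreate_word, preInner_word, wordInner]
  exact congrArg (fun f => f ξ η) h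

theorem preInner_preAnnihilate (e : E) (ξ η : X.PreFock) :
    X.preInner 1 (X.preCreate e ξ) η = X.preInner 1 ξ (X.preAnnihilate e η) := by
  have h : (X.preInner 1).comp (X.preCreate e) =
      (X.preInner 1).compl₂ (X.preAnnihilate e) := X.preInner_ext fun w x v y => by
    rcases v with _ | ⟨f, v⟩
    · simp [preCreate_word, preInner_word, wordInner, preAnnihilate_nil]
    · simp [preCreate_word, preInner_word, wordInner, preAnnihilate_cons, preInner_preLeft]
  exact congrArg (fun f => f ξ η) h

theorem preInner_preGauge (z : Circle) (ξ η : X.PreFock) :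
    X.preInner 1 (X.preGauge z ξ) (X.preGauge z η) = X.preInner 1 ξ η := by
  have h : ((X.preInner 1).comp (X.preGauge z)).compl₂ (X.preGauge z) = X.preInner 1 :=
    X.preInner_ext fun w x v y => by
      by_cases hwv : w.length = v.length
      · simp [preGauge_word, preInner_word, hwv, smul_smul, ← mul_pow, Complex.mul_conj]
      · simp [preGauge_word, preInner_word, X.wordInner_of_length_ne 1 w v hwv]
  exact congrArg (fun f => f ξ η) h

theorem norm_preLeft_le (a : A) (ξ : X.PreFock) : ‖X.preLeft a ξ‖ ≤ ‖a‖ * ‖ξ‖ := by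
  refine X.norm_le_of_preInner_le (norm_nonneg a) ?_
  rw [preInner_preLeft, preInner_preLeft_left, one_mul, pow_two, ← CStarRing.norm_star_mul_self]
  exact X.preInner_self_le (star_mul_self_nonneg a) ξ

theorem norm_preCreate_le (e : E) (ξ : X.PreFock) : ‖X.preCreate e ξ‖ ≤ ‖e‖ * ‖ξ‖ := by
  refine X.norm_le_of_preInner_le (norm_nonneg e) ?_
  rw [preInner_preCreate, map_one, one_apply_eq_self, ← norm_rightInner_self (A := A)]
  exact X.preInner_self_le (rightInner_self_nonneg e) ξ

theorem norm_preAnnihilate_le (e : E) (ξ : X.PreFock) : ‖X.preAnnihilate e ξ‖ ≤ ‖e‖ * ‖ξ‖ :=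
  X.norm_le_of_adjoint (norm_nonneg e) (X.norm_preCreate_le e) (X.preInner_preAnnihilate e) ξ

theorem norm_preGauge_le (z : Circle) (ξ : X.PreFock) : ‖X.preGauge z ξ‖ ≤ 1 * ‖ξ‖ := by
  rw [one_mul, norm_preFock_def, preInner_preGauge, ← norm_preFock_def]

/-- The Fock module `A ⊕ E ⊕ E^{⊗ 2} ⊕ ⋯`, as the (Hausdorff) completion of the algebraic Fock
module: vectors of norm zero are identified with `0`, and words of different lengths are
orthogonal. -/
abbrev Fock : Type _ := UniformSpace.Completion X.PreFock

/-- The action of `a` in `A` on the Fock module. -/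
noncomputable def left (a : A) : X.Fock →L[ℂ] X.Fock :=
  ((X.preLeft a).mkContinuous ‖a‖ (X.norm_preLeft_le a)).completion

/-- The creation operator of `e` on the Fock module. -/
noncomputable def create (e : E) : X.Fock →L[ℂ] X.Fock :=
  ((X.preCreate e).mkContinuous ‖e‖ (X.norm_preCreate_le e)).completion

/-- The annihilation operator of `e`, which is the adjoint of `create e`. -/
noncomputable def annihilate (e : E) : X.Fock →L[ℂ] X.Fock :=
  ((X.preAnnihilate e).mkContinuous ‖e‖ (X.norm_preAnnihilate_le e)).completion

/-- The unitary on the Fock module that scales `E^{⊗ n}` by `z ^ n`. -/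
noncomputable def gaugeUnitary (z : Circle) : X.Fock →L[ℂ] X.Fock :=
  ((X.preGauge z).mkContinuous 1 (X.norm_preGauge_le z)).completion

/-- The vector `e₁ ⊗ ⋯ ⊗ eₙ x` of the Fock module. -/
noncomputable def vec (w : List E) (x : A) : X.Fock := (X.word w x : X.PreFock)

theorem left_coe (a : A) (ξ : X.PreFock) : X.left a (ξ : X.Fock) = (X.preLeft a ξ : X.PreFock) :=
  ContinuousLinearMap.completion_apply_coe _ _

theorem create_coe (e : E) (ξ : X.PreFock) :
    X.create e (ξ : X.Fock) = (X.preCreate e ξ : X.PreFock) :=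
  ContinuousLinearMap.completion_apply_coe _ _

theorem annihilate_coe (e : E) (ξ : X.PreFock) :
    X.annihilate e (ξ : X.Fock) = (X.preAnnihilate e ξ : X.PreFock) :=
  ContinuousLinearMap.completion_apply_coe _ _

theorem gaugeUnitary_coe (z : Circle) (ξ : X.PreFock) :
    X.gaugeUnitary z (ξ : X.Fock) = (X.preGauge z ξ : X.PreFock) :=
  ContinuousLinearMap.completion_apply_coe _ _

theorem fock_ext {S T : X.Fock →L[ℂ] X.Fock}
    (h : ∀ w x, S (X.vec w x) = T (X.vec w x)) : S = T := by
  have h1 : (S.comp UniformSpace.Completion.toComplL : X.PreFock →L[ℂ] X.Fock).toLinearMap =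
      (T.comp UniformSpace.Completion.toComplL : X.PreFock →L[ℂ] X.Fock).toLinearMap :=
    X.preFock_hom_ext h
  refine ContinuousLinearMap.ext fun ξ => ?_
  refine UniformSpace.Completion.induction_on ξ (isClosed_eq S.continuous T.continuous) fun ξ => ?_
  exact congrArg (fun f => f ξ) h1

theorem fock_coe_eq {ξ η : X.PreFock}
    (h : ∀ v y, X.preInner 1 (X.word v y) ξ = X.preInner 1 (X.word v y) η) :
    (ξ : X.Fock) = (η : X.Fock) := by
  have h0 : ∀ ζ, X.preInner 1 ζ ξ = X.preInner 1 ζ η := fun ζ =>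
    X.word_induction (p := fun ζ => X.preInner 1 ζ ξ = X.preInner 1 ζ η) (by simp)
      (fun v y ζ hζ => by rw [map_add, LinearMap.add_apply, LinearMap.add_apply, h, hζ]) ζ
  have h1 : ‖ξ - η‖ = 0 := by
    rw [← sq_eq_zero_iff, norm_preFock_sq, map_sub, h0]
    simp
  rw [← sub_eq_zero, ← UniformSpace.Completion.coe_sub, ← norm_eq_zero,
    UniformSpace.Completion.norm_coe, h1]

theorem create_add (e f : E) : X.create (e + f) = X.create e + X.create f := by
  refine X.fock_ext fun w x => ?_
  rw [add_apply, vec, create_coe, create_coe, create_coe, ← UniformSpace.Completion.coe_add]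
  refine X.fock_coe_eq fun v y => ?_
  rcases v with _ | ⟨g, v⟩ <;>
  simp [preCreate_word, preInner_word, wordInner, rightInner_add_right, wordInner_add, mul_add,
    add_mul]

theorem create_smul (r : ℂ) (e : E) : X.create (r • e) = r • X.create e := by
  refine X.fock_ext fun w x => ?_
  rw [smul_apply, vec, create_coe, create_coe, ← UniformSpace.Completion.coe_smul]
  refine X.fock_coe_eq fun v y => ?_
  rcases v with _ | ⟨g, v⟩ <;>
  simp [preCreate_word, preInner_word, wordInner, rightInner_smul_right, wordInner_smul]

theorem create_mul_left (e : E) (a : A) :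
    X.create e * X.left a = X.create (MulOpposite.op a • e) := by
  refine X.fock_ext fun w x => ?_
  rw [mul_apply_eq_comp, vec, left_coe, create_coe, create_coe]
  refine X.fock_coe_eq fun v y => ?_
  rw [preCreate_word]
  rcases v with _ | ⟨g, v⟩
  · rcases w with _ | ⟨f, w⟩ <;>
    simp [preCreate_word, preInner_word, wordInner, preLeft_nil, preLeft_cons]
  · rw [← preCreate_word, preInner_preCreate, preInner_preLeft, preInner_word, preCreate_word,
      preInner_word]
    simp [wordInner, rightInner_op_smul_right]

theorem annihilate_mul_create (e f : E) :
    X.annihilate e * X.create f = X.left (rightInner A e f) := by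
  refine X.fock_ext fun w x => ?_
  rw [mul_apply_eq_comp, vec, create_coe, annihilate_coe, left_coe, preCreate_word,
    preAnnihilate_cons]

theorem annihilate_vec_nil (e : E) (x : A) : X.annihilate e (X.vec [] x) = 0 := by
  rw [vec, annihilate_coe, preAnnihilate_nil, UniformSpace.Completion.coe_zero]

/-- The rank one operator `|x⟩⟨y| : z ↦ x ⟨y, z⟩` on the Hilbert module `E`. -/
noncomputable def rankOne (A : Type*) {E : Type*} [CStarAlgebra A] [PartialOrder A]
    [StarOrderedRing A] [NormedAddCommGroup E] [NormedSpace ℂ E] [Module Aᵐᵒᵖ E]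
    [CStarModule Aᵐᵒᵖ E] (x y : E) : E →L[ℂ] E :=
  LinearMap.mkContinuous
    { toFun := fun z => MulOpposite.op (rightInner A y z) • x
      map_add' := fun z z' => by rw [rightInner_add_right, MulOpposite.op_add, add_smul]
      map_smul' := fun r z => ext_rightInner (A := A) fun u => by
        rw [rightInner_smul_right, RingHom.id_apply, rightInner_smul_right,
          rightInner_op_smul_right, rightInner_op_smul_right, mul_smul_comm] }
    (‖y‖ * ‖x‖) fun z => by
      refine (norm_op_smul_le _ _).trans ?_
      have h := norm_rightInner_le (A := A) y z
      calc ‖rightInner A y z‖ * ‖x‖ ≤ (‖y‖ * ‖z‖) * ‖x‖ := by gcongr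
        _ = ‖y‖ * ‖x‖ * ‖z‖ := by ring

theorem rankOne_apply (x y z : E) : rankOne A x y z = MulOpposite.op (rightInner A y z) • x := rfl

/-- The compact operators `K(E)` on the Hilbert module `E`: the closed linear span of the rank one
operators. -/
noncomputable def compacts (A E : Type*) [CStarAlgebra A] [PartialOrder A]
    [StarOrderedRing A] [NormedAddCommGroup E] [NormedSpace ℂ E] [Module Aᵐᵒᵖ E]
    [CStarModule Aᵐᵒᵖ E] : Submodule ℂ (E →L[ℂ] E) :=
  (Submodule.span ℂ (Set.range fun p : E × E => rankOne A p.1 p.2)).topologicalClosure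

/-- Katsura's ideal `J_E = φ⁻¹(K(E)) ∩ (ker φ)^⊥`. -/
noncomputable def katsuraIdeal : Submodule ℂ A where
  carrier := {a | X.φ a ∈ compacts A E ∧ ∀ b, X.φ b = 0 → a * b = 0 ∧ b * a = 0}
  zero_mem' := by simp
  add_mem' := fun ha hb =>
    ⟨by rw [map_add]; exact Submodule.add_mem _ ha.1 hb.1, fun c hc => by
      simp [add_mul, mul_add, ha.2 c hc, hb.2 c hc]⟩
  smul_mem' := fun r a ha =>
    ⟨by rw [map_smul]; exact Submodule.smul_mem _ r ha.1, fun c hc => by simp [ha.2 c hc]⟩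

/-- The ideals `I_n`: `I_0 = A`, `I_1` is the closed span of the inner products `⟨e, f⟩`, and
`I_{n+1}` is the closed span of the `⟨e, φ(x) f⟩` for `x` in `I_n`. -/
noncomputable def innerIdeal : ℕ → Submodule ℂ A
  | 0 => ⊤
  | 1 => (Submodule.span ℂ {a | ∃ e f : E, a = rightInner A e f}).topologicalClosure
  | n + 2 => (Submodule.span ℂ
      {a | ∃ e f : E, ∃ x ∈ innerIdeal (n + 1), a = rightInner A e (X.φ x f)}).topologicalClosure

/-- The Pimsner-Toeplitz algebra `T_E`: the norm closed algebra of operators on the Fock module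
generated by `A`, the creation operators and their adjoints, the annihilation operators. -/
noncomputable def toeplitz : Subalgebra ℂ (X.Fock →L[ℂ] X.Fock) :=
  (Algebra.adjoin ℂ
    (Set.range X.left ∪ Set.range X.create ∪ Set.range X.annihilate)).topologicalClosure

theorem left_mem (a : A) : X.left a ∈ X.toeplitz :=
  Subalgebra.le_topologicalClosure _ (Algebra.subset_adjoin (Or.inl (Or.inl ⟨a, rfl⟩)))

theorem create_mem (e : E) : X.create e ∈ X.toeplitz :=
  Subalgebra.le_topologicalClosure _ (Algebra.subset_adjoin (Or.inl (Or.inr ⟨e, rfl⟩)))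

theorem annihilate_mem (e : E) : X.annihilate e ∈ X.toeplitz :=
  Subalgebra.le_topologicalClosure _ (Algebra.subset_adjoin (Or.inr ⟨e, rfl⟩))

theorem isClosed_toeplitz : IsClosed (X.toeplitz : Set (X.Fock →L[ℂ] X.Fock)) :=
  Subalgebra.isClosed_topologicalClosure _

/-- The image of `a` in the Toeplitz algebra. -/
noncomputable def toeplitzLeft (a : A) : X.toeplitz := ⟨X.left a, X.left_mem a⟩

/-- The closure of the linear span of the pairs `(|e⟩⟨f|, e f⋆)`. It is the graph of the linear map
`ψ₁ : K(E) → T_E` with `ψ₁(|e⟩⟨f|) = e f⋆`. -/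
noncomputable def psiGraph : Submodule ℂ ((E →L[ℂ] E) × (X.Fock →L[ℂ] X.Fock)) :=
  (Submodule.span ℂ (Set.range fun p : E × E =>
    (rankOne A p.1 p.2, X.create p.1 * X.annihilate p.2))).topologicalClosure

theorem rightInner_map_self_le {k : E →L[ℂ] E}
    (hk : ∀ (a : A) (x : E), k (MulOpposite.op a • x) = MulOpposite.op a • k x) (y : E) :
    rightInner A (k y) (k y) ≤ ‖k‖ ^ 2 • rightInner A y y := by
  have key : ∀ ε : ℝ, 0 < ε → rightInner A (k y) (k y) ≤
      ‖k‖ ^ 2 • (rightInner A y y + algebraMap ℝ A ε) := by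
    intro ε hε
    set q := rightInner A y y + algebraMap ℝ A ε with hq
    have hq0 : IsStrictlyPositive q :=
      IsStrictlyPositive.nonneg_add (rightInner_self_nonneg y) (by grind)
    set b := q ^ (-(1 / 2) : ℝ) with hb
    set d := q ^ (1 / 2 : ℝ) with hd
    have hb0 : star b = b := (IsSelfAdjoint.of_nonneg CFC.rpow_nonneg).star_eq
    have hd0 : star d = d := (IsSelfAdjoint.of_nonneg CFC.rpow_nonneg).star_eq
    have hbqb : b * q * b = 1 := CFC.conjugate_rpow_neg_one_half q hq0
    have hbd : b * d = 1 := CFC.rpow_neg_mul_rpow _ hq0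
    have hdb : d * b = 1 := CFC.rpow_mul_rpow_neg _ hq0
    have hq1 : d * d = q := by
      calc d * d = d * (b * q * b) * d := by rw [hbqb, mul_one]
        _ = (d * b) * q * (b * d) := by noncomm_ring
        _ = q := by rw [hdb, hbd, one_mul, mul_one]
    have h1 : ‖MulOpposite.op b • y‖ ≤ 1 := by
      rw [← sq_le_one_iff₀ (norm_nonneg _), ← norm_rightInner_self (A := A),
        CStarAlgebra.norm_le_one_iff_of_nonneg _ (rightInner_self_nonneg _),
        rightInner_op_smul_right, rightInner_op_smul_left, ← hbqb]
      nth_rw 3 [← hb0]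
      refine star_left_conjugate_le_conjugate ?_ b
      rw [hq]
      exact le_add_of_nonneg_right (algebraMap_nonneg A hε.le)
    have h2 : star b * rightInner A (k y) (k y) * b ≤ algebraMap ℝ A (‖k‖ ^ 2) := by
      rw [← rightInner_op_smul_left, ← rightInner_op_smul_right, ← hk]
      refine (IsSelfAdjoint.of_nonneg (rightInner_self_nonneg _)).le_algebraMap_norm_self.trans ?_
      refine algebraMap_mono A ?_
      rw [norm_rightInner_self]
      have h3 := k.le_of_opNorm_le_of_le le_rfl h1
      rw [mul_one] at h3
      gcongr
    have h4 := star_left_conjugate_le_conjugate h2 d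
    have h5 : star d * (star b * rightInner A (k y) (k y) * b) * d = rightInner A (k y) (k y) := by
      rw [hd0, hb0]
      calc d * (b * rightInner A (k y) (k y) * b) * d
          = (d * b) * rightInner A (k y) (k y) * (b * d) := by noncomm_ring
        _ = _ := by rw [hdb, hbd, one_mul, mul_one]
    rw [h5, hd0, Algebra.algebraMap_eq_smul_one, mul_smul_comm, smul_mul_assoc, mul_one, hq1] at h4
    exact h4
  have hc : Filter.Tendsto (fun ε : ℝ => ‖k‖ ^ 2 • (rightInner A y y + algebraMap ℝ A ε))
      (nhdsWithin 0 (Set.Ioi 0)) (nhds (‖k‖ ^ 2 • (rightInner A y y + algebraMap ℝ A 0))) :=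
    (Continuous.tendsto (by fun_prop) 0).mono_left nhdsWithin_le_nhds
  rw [map_zero, add_zero] at hc
  exact ge_of_tendsto hc (Filter.eventually_of_mem self_mem_nhdsWithin fun ε hε => key ε hε)

/-- The operator `k ⊗ 1` on the summands other than `A` of the algebraic Fock module. -/
noncomputable def preAmp (k : E →L[ℂ] E) : X.PreFock →ₗ[ℂ] X.PreFock :=
  X.wordLift fun
    | [] => 0
    | f :: w => X.word (k f :: w)

theorem preInner_sum {ι : Type*} (s : Finset ι) (c : A) (ξ : ι → X.PreFock) :
    X.preInner c (∑ i ∈ s, ξ i) (∑ i ∈ s, ξ i) = ∑ i ∈ s, ∑ j ∈ s, X.preInner c (ξ i) (ξ j) := by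
  rw [map_sum, Finset.sum_comm]
  refine Finset.sum_congr rfl fun i _ => ?_
  rw [map_sum, LinearMap.sum_apply]

theorem norm_preAmp_le {k : E →L[ℂ] E}
    (hk : ∀ (a : A) (x : E), k (MulOpposite.op a • x) = MulOpposite.op a • k x) (ξ : X.PreFock) :
    ‖X.preAmp k ξ‖ ≤ ‖k‖ * ‖ξ‖ := by
  refine X.norm_le_of_preInner_le (norm_nonneg k) ?_
  obtain ⟨s, x, rfl⟩ := X.preFock_eq_sum ξ
  let e : s → E := fun w => w.1.headD 0
  let M : s → s → A := fun w v =>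
    (‖k‖ ^ 2) • rightInner A (e w) (e v) - rightInner A (k (e w)) (k (e v))
  have hM : PosKernel M :=
    { star_eq := fun w v => by simp [M, star_rightInner]
      nonneg := fun y => by
        have h1 : ∑ w, ∑ v, star (y w) * M w v * y v =
            (‖k‖ ^ 2) • rightInner A (∑ w, MulOpposite.op (y w) • e w)
              (∑ w, MulOpposite.op (y w) • e w) -
            rightInner A (k (∑ w, MulOpposite.op (y w) • e w))
              (k (∑ w, MulOpposite.op (y w) • e w)) := by
          simp only [map_sum, hk, rightInner_sum_left, rightInner_sum_right,
            rightInner_op_smul_left, rightInner_op_smul_right, M, mul_sub, sub_mul,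
            Finset.sum_sub_distrib, Finset.smul_sum, Finset.sum_mul, mul_smul_comm, smul_mul_assoc]
          congr 1 <;> exact Finset.sum_comm
        rw [h1, sub_nonneg]
        exact rightInner_map_self_le hk _ }
  classical
  have h2 := ((PosKernel.const (ι := s) (c := (‖k‖ ^ 2) • (1 : A))
    (smul_nonneg (by positivity) zero_le_one)).restrict
    fun w => w.1 = []).add ((hM.wordInner X fun w => w.1.tail).restrict fun w => w.1 ≠ [])
  have h3 := h2.nonneg fun w => x w
  have h4 : ‖k‖ ^ 2 • X.preInner 1 (∑ w ∈ s, X.word w (x w)) (∑ w ∈ s, X.word w (x w)) -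
      X.preInner 1 (X.preAmp k (∑ w ∈ s, X.word w (x w)))
        (X.preAmp k (∑ w ∈ s, X.word w (x w))) =
      ∑ w : s, ∑ v : s, (‖k‖ ^ 2 • X.preInner 1 (X.word w (x w)) (X.word v (x v)) -
        X.preInner 1 (X.preAmp k (X.word w (x w))) (X.preAmp k (X.word v (x v)))) := by
    rw [← Finset.sum_coe_sort s, preInner_sum, map_sum (X.preAmp k), preInner_sum]
    simp only [Finset.smul_sum, Finset.sum_sub_distrib]
  rw [← sub_nonneg, h4]
  refine h3.trans_eq (Finset.sum_congr rfl fun w _ => Finset.sum_congr rfl fun v _ => ?_)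
  obtain ⟨w, hw⟩ := w
  obtain ⟨v, hv⟩ := v
  rcases w with _ | ⟨g, w⟩ <;> rcases v with _ | ⟨f, v⟩ <;>
  simp [preAmp, wordLift_word, preInner_word, wordInner, M, e]
  have h5 : ∀ (r : ℝ) (p q : A), X.wordInner (r • p - q) w v =
      r • X.wordInner p w v - X.wordInner q w v := fun r p q => by
    have h6 : r • p - q = (r : ℂ) • p + (-1 : ℂ) • q := by simp [sub_eq_add_neg]
    rw [h6, wordInner_add, wordInner_smul, wordInner_smul]
    simp [sub_eq_add_neg]
  rw [h5, mul_sub, sub_mul, mul_smul_comm, smul_mul_assoc]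

theorem psi_spec {p : (E →L[ℂ] E) × (X.Fock →L[ℂ] X.Fock)}
    (hp : p ∈ Submodule.span ℂ (Set.range fun p : E × E =>
      (rankOne A p.1 p.2, X.create p.1 * X.annihilate p.2))) :
    (∀ (a : A) (x : E), p.1 (MulOpposite.op a • x) = MulOpposite.op a • p.1 x) ∧
    (∀ f, p.2 * X.create f = X.create (p.1 f)) ∧ (∀ x, p.2 (X.vec [] x) = 0) ∧
      p.2 ∈ X.toeplitz := by
  induction hp using Submodule.span_induction with
  | mem p hp =>
    obtain ⟨⟨e, f⟩, rfl⟩ := hp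
    refine ⟨fun a x => ?_, fun g => ?_, fun x => ?_, ?_⟩
    · simp only [rankOne_apply]
      rw [rightInner_op_smul_right, MulOpposite.op_mul, mul_smul]
    · rw [mul_assoc, annihilate_mul_create, create_mul_left, rankOne_apply]
    · rw [mul_apply_eq_comp, annihilate_vec_nil, map_zero]
    · exact mul_mem (X.create_mem e) (X.annihilate_mem f)
  | zero =>
    refine ⟨by simp, fun f => ?_, by simp, zero_mem _⟩
    have h := X.create_smul 0 0
    rw [zero_smul, zero_smul] at h
    simp [h]
  | add p q _ _ hp hq =>
    refine ⟨fun a x => ?_, fun f => ?_, fun x => ?_, add_mem hp.2.2.2 hq.2.2.2⟩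
    · simp [hp.1, hq.1]
    · simp [add_mul, hp.2.1, hq.2.1, create_add]
    · simp [hp.2.2.1, hq.2.2.1]
  | smul r p _ hp =>
    refine ⟨fun a x => ?_, fun f => ?_, fun x => ?_, Subalgebra.smul_mem _ hp.2.2.2 r⟩
    · refine ext_rightInner (A := A) fun u => ?_
      simp [hp.1, rightInner_smul_right, rightInner_op_smul_right]
    · simp [hp.2.1, create_smul]
    · simp [hp.2.2.1]

theorem psi_norm_le {p : (E →L[ℂ] E) × (X.Fock →L[ℂ] X.Fock)} (hp : p ∈ X.psiGraph) :
    ‖p.2‖ ≤ ‖p.1‖ := by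
  refine closure_minimal (t := {p | ‖p.2‖ ≤ ‖p.1‖}) (fun p hp => ?_)
    (isClosed_le (by fun_prop) (by fun_prop)) hp
  obtain ⟨h1, h2, h3, -⟩ := X.psi_spec hp
  have h4 : ∀ ξ : X.PreFock, p.2 (ξ : X.Fock) = (X.preAmp p.1 ξ : X.PreFock) := by
    intro ξ
    have h5 : (p.2.comp UniformSpace.Completion.toComplL : X.PreFock →L[ℂ] X.Fock).toLinearMap =
        (UniformSpace.Completion.toComplL : X.PreFock →L[ℂ] X.Fock).toLinearMap ∘ₗ
          X.preAmp p.1 := by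
      refine X.preFock_hom_ext fun w x => ?_
      rcases w with _ | ⟨f, w⟩
      · refine (h3 x).trans ?_
        simp [preAmp, wordLift_word, UniformSpace.Completion.coe_zero]
      · have h6 := congrArg (fun T : X.Fock →L[ℂ] X.Fock => T (X.vec w x)) (h2 f)
        simp only [mul_apply_eq_comp, vec, create_coe, preCreate_word] at h6
        refine h6.trans ?_
        simp [preAmp, wordLift_word]
    exact congrArg (fun f => f ξ) h5
  refine ContinuousLinearMap.opNorm_le_bound _ (norm_nonneg _) fun ξ => ?_
  refine UniformSpace.Completion.induction_on ξ
    (isClosed_le (by fun_prop) (by fun_prop)) fun ξ => ?_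
  rw [h4, UniformSpace.Completion.norm_coe, UniformSpace.Completion.norm_coe]
  exact X.norm_preAmp_le h1 ξ

theorem psi_existsUnique [CompleteSpace E] (k : compacts A E) :
    ∃! s : X.toeplitz, (k.1, s.1) ∈ X.psiGraph := by
  have hmem : ∀ p ∈ X.psiGraph, p.2 ∈ X.toeplitz := fun p hp =>
    closure_minimal (t := Prod.snd ⁻¹' (X.toeplitz : Set (X.Fock →L[ℂ] X.Fock)))
      (fun p hp => (X.psi_spec hp).2.2.2)
      (X.isClosed_toeplitz.preimage continuous_snd) hp
  have hcomplete : CompleteSpace X.psiGraph :=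
    (Submodule.isClosed_topologicalClosure _).completeSpace_coe
  let g : X.psiGraph →L[ℂ] (E →L[ℂ] E) := (ContinuousLinearMap.fst ℂ _ _).comp X.psiGraph.subtypeL
  have hg : AntilipschitzWith 1 g := g.antilipschitz_of_bound fun p => by
    rw [NNReal.coe_one, one_mul]
    exact max_le le_rfl (X.psi_norm_le p.2)
  have hrange : compacts A E ≤ g.range := by
    refine Submodule.topologicalClosure_minimal _ (Submodule.span_le.mpr ?_)
      (hg.isClosed_range g.uniformContinuous)
    rintro _ ⟨p, rfl⟩
    exact ⟨⟨_, Submodule.le_topologicalClosure _ (Submodule.subset_span ⟨p, rfl⟩)⟩, rfl⟩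
  obtain ⟨p, hp⟩ := hrange k.2
  refine ⟨⟨p.1.2, hmem p.1 p.2⟩, ?_, fun t ht => ?_⟩
  · rw [← show p.1.1 = k.1 from hp]
    exact p.2
  · have h1 := X.psiGraph.sub_mem ht p.2
    have h2 := X.psi_norm_le h1
    rw [Prod.fst_sub, Prod.snd_sub, show p.1.1 = k.1 from hp, sub_self, norm_zero] at h2
    exact Subtype.ext (sub_eq_zero.mp (norm_le_zero_iff.mp h2))

/-- The map `ψ₁ : K(E) → T_E` with `ψ₁(|e⟩⟨f|) = e f⋆`: the value at `k` is the only element `s` with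
`(k, s)` in the closed linear span of the pairs `(|e⟩⟨f|, e f⋆)`. -/
noncomputable def psi [CompleteSpace E] (k : compacts A E) : X.toeplitz :=
  (X.psi_existsUnique k).choose

/-- The closed two-sided ideal of the Toeplitz algebra generated by the elements `a - ψ₁(φ(a))` for
`a` in Katsura's ideal. -/
noncomputable def cpIdeal [CompleteSpace E] : Ideal X.toeplitz :=
  (TwoSidedIdeal.span {t : X.toeplitz | ∃ (a : A) (ha : a ∈ X.katsuraIdeal),
    t = X.toeplitzLeft a - X.psi ⟨X.φ a, ha.1⟩}).asIdeal.closure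

instance [CompleteSpace E] : X.cpIdeal.IsTwoSided where
  mul_mem_of_left {a} b ha := by
    exact map_mem_closure (f := fun x : X.toeplitz => x * b) (continuous_mul_const b) ha
      fun x hx => Ideal.mul_mem_right b _ hx

/-- The Cuntz-Pimsner algebra `O_E`, with the quotient topology, which is the topology of the
quotient norm. -/
abbrev CuntzPimsner [CompleteSpace E] : Type _ := X.toeplitz ⧸ X.cpIdeal

theorem gaugeUnitary_mul (z z' : Circle) :
    X.gaugeUnitary (z * z') = X.gaugeUnitary z * X.gaugeUnitary z' := by
  refine X.fock_ext fun w x => ?_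
  rw [mul_apply_eq_comp, vec, gaugeUnitary_coe, gaugeUnitary_coe, gaugeUnitary_coe]
  simp [preGauge_word, mul_pow, smul_smul, mul_comm]

theorem gaugeUnitary_one : X.gaugeUnitary 1 = 1 := by
  refine X.fock_ext fun w x => ?_
  rw [vec, gaugeUnitary_coe]
  simp [preGauge_word]

theorem gaugeUnitary_inv_mul (z : Circle) : X.gaugeUnitary z⁻¹ * X.gaugeUnitary z = 1 := by
  rw [← gaugeUnitary_mul, inv_mul_cancel, gaugeUnitary_one]

/-- Conjugation by the unitary that scales `E^{⊗ n}` by `z ^ n`. -/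
noncomputable def conj (z : Circle) : (X.Fock →L[ℂ] X.Fock) →ₐ[ℂ] (X.Fock →L[ℂ] X.Fock) :=
  AlgHom.ofLinearMap
    (LinearMap.mulLeftRight ℂ (X.gaugeUnitary z, X.gaugeUnitary z⁻¹))
    (by simp [← gaugeUnitary_mul, gaugeUnitary_one])
    (fun S T => by
      simp only [LinearMap.mulLeftRight_apply]
      calc X.gaugeUnitary z * (S * T) * X.gaugeUnitary z⁻¹
          = X.gaugeUnitary z * S * 1 * T * X.gaugeUnitary z⁻¹ := by noncomm_ring
        _ = _ := by rw [← X.gaugeUnitary_inv_mul z]; noncomm_ring)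

theorem conj_apply (z : Circle) (T : X.Fock →L[ℂ] X.Fock) :
    X.conj z T = X.gaugeUnitary z * T * X.gaugeUnitary z⁻¹ := rfl

theorem continuous_conj (z : Circle) : Continuous (X.conj z) := by
  simp only [funext (X.conj_apply z)]
  fun_prop

theorem gaugeUnitary_vec (z : Circle) (w : List E) (x : A) :
    X.gaugeUnitary z (X.vec w x) = (z : ℂ) ^ w.length • X.vec w x := by
  rw [vec, gaugeUnitary_coe, preGauge_word, UniformSpace.Completion.coe_smul]

theorem left_vec_nil (a x : A) : X.left a (X.vec [] x) = X.vec [] (a * x) := by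
  rw [vec, left_coe, preLeft_nil, vec]

theorem left_vec_cons (a x : A) (e : E) (w : List E) :
    X.left a (X.vec (e :: w) x) = X.vec (X.φ a e :: w) x := by
  rw [vec, left_coe, preLeft_cons, vec]

theorem create_vec (e : E) (w : List E) (x : A) :
    X.create e (X.vec w x) = X.vec (e :: w) x := by
  rw [vec, create_coe, preCreate_word, vec]

theorem annihilate_vec_cons (e f : E) (w : List E) (x : A) :
    X.annihilate e (X.vec (f :: w) x) = X.left (rightInner A e f) (X.vec w x) := by
  rw [vec, annihilate_coe, preAnnihilate_cons, vec, left_coe]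

theorem gaugeUnitary_mul_left (z : Circle) (a : A) :
    X.gaugeUnitary z * X.left a = X.left a * X.gaugeUnitary z := by
  refine X.fock_ext fun w x => ?_
  rw [mul_apply_eq_comp, mul_apply_eq_comp, gaugeUnitary_vec, map_smul]
  rcases w with _ | ⟨f, w⟩
  · rw [left_vec_nil, gaugeUnitary_vec]
  · rw [left_vec_cons, gaugeUnitary_vec, List.length_cons, List.length_cons]

theorem gaugeUnitary_mul_create (z : Circle) (e : E) :
    X.gaugeUnitary z * X.create e = X.create ((z : ℂ) • e) * X.gaugeUnitary z := by
  refine X.fock_ext fun w x => ?_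
  rw [mul_apply_eq_comp, mul_apply_eq_comp, gaugeUnitary_vec, map_smul, create_vec,
    gaugeUnitary_vec, create_smul, smul_apply, create_vec, smul_smul, List.length_cons, pow_succ]

theorem left_smul (r : ℂ) (a : A) : X.left (r • a) = r • X.left a := by
  refine X.fock_ext fun w x => ?_
  rw [smul_apply]
  rcases w with _ | ⟨f, w⟩
  · rw [left_vec_nil, left_vec_nil, smul_mul_assoc, vec, map_smul, UniformSpace.Completion.coe_smul,
      vec]
  · rw [left_vec_cons, left_vec_cons, map_smul, smul_apply, ← create_vec, create_smul, smul_apply,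
      create_vec]

theorem gaugeUnitary_mul_annihilate (z : Circle) (e : E) :
    X.gaugeUnitary z * X.annihilate e = X.annihilate ((z : ℂ) • e) * X.gaugeUnitary z := by
  refine X.fock_ext fun w x => ?_
  rw [mul_apply_eq_comp, mul_apply_eq_comp, gaugeUnitary_vec, map_smul]
  rcases w with _ | ⟨f, w⟩
  · rw [annihilate_vec_nil, annihilate_vec_nil, map_zero, smul_zero]
  · have h := congrArg (fun T : X.Fock →L[ℂ] X.Fock => T (X.vec w x))
      (X.gaugeUnitary_mul_left z (rightInner A e f))
    simp only [mul_apply_eq_comp, gaugeUnitary_vec, map_smul] at h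
    have hz : (z : ℂ) ^ (w.length + 1) * star (z : ℂ) = (z : ℂ) ^ w.length := by
      rw [pow_succ, mul_assoc, Complex.star_def, Complex.mul_conj]
      simp
    rw [annihilate_vec_cons, annihilate_vec_cons, h, rightInner_smul_left, left_smul, smul_apply,
      smul_smul, List.length_cons, hz]

theorem conj_eq {z : Circle} {S T : X.Fock →L[ℂ] X.Fock}
    (h : X.gaugeUnitary z * S = T * X.gaugeUnitary z) : X.conj z S = T := by
  rw [conj_apply, h, mul_assoc, ← gaugeUnitary_mul, mul_inv_cancel, gaugeUnitary_one, mul_one]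

theorem toeplitz_le {S : Subalgebra ℂ (X.Fock →L[ℂ] X.Fock)}
    (hS : IsClosed (S : Set (X.Fock →L[ℂ] X.Fock))) (h1 : ∀ a, X.left a ∈ S)
    (h2 : ∀ e, X.create e ∈ S) (h3 : ∀ e, X.annihilate e ∈ S) : X.toeplitz ≤ S := by
  refine Subalgebra.topologicalClosure_minimal (Algebra.adjoin_le ?_) hS
  rintro _ ((⟨a, rfl⟩ | ⟨e, rfl⟩) | ⟨e, rfl⟩)
  · exact h1 a
  · exact h2 e
  · exact h3 e

theorem toeplitz_le_comap (z : Circle) : X.toeplitz ≤ X.toeplitz.comap (X.conj z) := by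
  refine X.toeplitz_le ?_ (fun a => ?_) (fun e => ?_) fun e => ?_
  · rw [Subalgebra.coe_comap]
    exact X.isClosed_toeplitz.preimage (X.continuous_conj z)
  · rw [Subalgebra.mem_comap, X.conj_eq (X.gaugeUnitary_mul_left z a)]
    exact X.left_mem a
  · rw [Subalgebra.mem_comap, X.conj_eq (X.gaugeUnitary_mul_create z e)]
    exact X.create_mem _
  · rw [Subalgebra.mem_comap, X.conj_eq (X.gaugeUnitary_mul_annihilate z e)]
    exact X.annihilate_mem _

theorem conj_mem (z : Circle) {T : X.Fock →L[ℂ] X.Fock} (hT : T ∈ X.toeplitz) :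
    X.conj z T ∈ X.toeplitz :=
  (Subalgebra.mem_comap _ _ _).mp (X.toeplitz_le_comap z hT)

/-- The gauge automorphism of the Toeplitz algebra: it fixes `A` and scales `e` in `E` by `z`. -/
noncomputable def toeplitzGauge (z : Circle) : X.toeplitz →ₐ[ℂ] X.toeplitz :=
  ((X.conj z).comp X.toeplitz.val).codRestrict X.toeplitz fun T => X.conj_mem z T.2

theorem annihilate_smul (r : ℂ) (e : E) : X.annihilate (r • e) = star r • X.annihilate e := by
  refine X.fock_ext fun w x => ?_
  rw [smul_apply]
  rcases w with _ | ⟨f, w⟩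
  · rw [annihilate_vec_nil, annihilate_vec_nil, smul_zero]
  · rw [annihilate_vec_cons, annihilate_vec_cons, rightInner_smul_left, left_smul, smul_apply]

theorem conj_create_mul_annihilate (z : Circle) (e f : E) :
    X.conj z (X.create e * X.annihilate f) = X.create e * X.annihilate f := by
  rw [map_mul, X.conj_eq (X.gaugeUnitary_mul_create z e),
    X.conj_eq (X.gaugeUnitary_mul_annihilate z f), create_smul, annihilate_smul,
    smul_mul_smul_comm, Complex.star_def, Complex.mul_conj]
  simp

theorem conj_psiGraph (z : Circle) {p : (E →L[ℂ] E) × (X.Fock →L[ℂ] X.Fock)}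
    (hp : p ∈ X.psiGraph) : X.conj z p.2 = p.2 := by
  let N : Submodule ℂ ((E →L[ℂ] E) × (X.Fock →L[ℂ] X.Fock)) :=
    LinearMap.eqLocus ((X.conj z).toLinearMap ∘ₗ LinearMap.snd ℂ _ _) (LinearMap.snd ℂ _ _)
  have hN : IsClosed (N : Set ((E →L[ℂ] E) × (X.Fock →L[ℂ] X.Fock))) :=
    isClosed_eq ((X.continuous_conj z).comp continuous_snd) continuous_snd
  have h : X.psiGraph ≤ N := by
    refine Submodule.topologicalClosure_minimal _ (Submodule.span_le.mpr ?_) hN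
    rintro _ ⟨⟨e, f⟩, rfl⟩
    exact X.conj_create_mul_annihilate z e f
  exact h hp

theorem toeplitzGauge_psi [CompleteSpace E] (z : Circle) (k : compacts A E) :
    X.toeplitzGauge z (X.psi k) = X.psi k :=
  Subtype.ext (X.conj_psiGraph z (X.psi_existsUnique k).choose_spec.1)

theorem toeplitzGauge_left (z : Circle) (a : A) :
    X.toeplitzGauge z (X.toeplitzLeft a) = X.toeplitzLeft a :=
  Subtype.ext (X.conj_eq (X.gaugeUnitary_mul_left z a))

theorem continuous_toeplitzGauge (z : Circle) : Continuous (X.toeplitzGauge z) :=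
  Continuous.subtype_mk ((X.continuous_conj z).comp continuous_subtype_val) _

theorem cpIdeal_le_comap [CompleteSpace E] (z : Circle) :
    X.cpIdeal ≤ Ideal.comap (X.toeplitzGauge z) X.cpIdeal := by
  intro t ht
  refine map_mem_closure (X.continuous_toeplitzGauge z) ht fun s hs => ?_
  have h : TwoSidedIdeal.span {t : X.toeplitz | ∃ (a : A) (ha : a ∈ X.katsuraIdeal),
      t = X.toeplitzLeft a - X.psi ⟨X.φ a, ha.1⟩} ≤ (TwoSidedIdeal.span
      {t : X.toeplitz | ∃ (a : A) (ha : a ∈ X.katsuraIdeal),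
        t = X.toeplitzLeft a - X.psi ⟨X.φ a, ha.1⟩}).comap (X.toeplitzGauge z) := by
    rw [TwoSidedIdeal.span_le]
    rintro _ ⟨a, ha, rfl⟩
    rw [SetLike.mem_coe, TwoSidedIdeal.mem_comap, map_sub, toeplitzGauge_left, toeplitzGauge_psi]
    exact TwoSidedIdeal.subset_span ⟨a, ha, rfl⟩
  exact TwoSidedIdeal.mem_comap _ |>.mp (h hs)

theorem toeplitzGauge_one (t : X.toeplitz) : X.toeplitzGauge 1 t = t :=
  Subtype.ext (X.conj_eq (by rw [gaugeUnitary_one, one_mul, mul_one]; rfl))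

theorem toeplitzGauge_mul (z z' : Circle) (t : X.toeplitz) :
    X.toeplitzGauge (z * z') t = X.toeplitzGauge z (X.toeplitzGauge z' t) := by
  refine Subtype.ext ?_
  change X.conj (z * z') t.1 = X.conj z (X.conj z' t.1)
  rw [conj_apply, conj_apply, conj_apply, mul_inv_rev, gaugeUnitary_mul, gaugeUnitary_mul]
  noncomm_ring

/-- The gauge action of the circle group on the Cuntz-Pimsner algebra, by algebra
automorphisms (inverse to each other for `z` and `z⁻¹`); it fixes `A` and scales `e` in `E` by
`z`. -/
noncomputable def gauge [CompleteSpace E] :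
    Circle →* (X.CuntzPimsner →ₐ[ℂ] X.CuntzPimsner) where
  toFun z := Ideal.quotientMapₐ X.cpIdeal (X.toeplitzGauge z) (X.cpIdeal_le_comap z)
  map_one' := by
    refine AlgHom.ext fun b => ?_
    obtain ⟨t, rfl⟩ := Ideal.Quotient.mk_surjective b
    exact congrArg (Ideal.Quotient.mk X.cpIdeal) (X.toeplitzGauge_one t)
  map_mul' z z' := by
    refine AlgHom.ext fun b => ?_
    obtain ⟨t, rfl⟩ := Ideal.Quotient.mk_surjective b
    exact congrArg (Ideal.Quotient.mk X.cpIdeal) (X.toeplitzGauge_mul z z' t)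

/-- The restriction of the gauge action to `ℤ/k`, embedded in the circle by
`j ↦ exp (2 π i j / k)`. -/
noncomputable def gaugeZMod [CompleteSpace E] (k : ℕ) [NeZero k] :
    Multiplicative (ZMod k) →* (X.CuntzPimsner →ₐ[ℂ] X.CuntzPimsner) :=
  X.gauge.comp ZMod.toCircle.toMonoidHom

end Fock

end CStarCorrespondence

/-- Freeness of an action `α` of a finite group `G` on a topological algebra `B`. For finite `G` the
tensor product `B ⊗ C(G)` is the algebra of all functions `G → B` with the topology of (uniform)
convergence, and the coaction sends `b` to `g ↦ α g b`. The action is free if the linear span of the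
elements `(a ⊗ 1) ρ(b)` is dense. -/
def IsFreeAction {G B : Type*} [Group G] [Finite G] [Ring B] [Algebra ℂ B] [TopologicalSpace B]
    (α : G →* (B →ₐ[ℂ] B)) : Prop :=
  Dense (Submodule.span ℂ {f : G → B | ∃ a b : B, f = fun g => a * α g b} : Set (G → B))

/-! ### Topology of quotients of topological rings. -/

section QuotientTopology

variable {R : Type*} [Ring R] [TopologicalSpace R] [IsTopologicalRing R] (I : Ideal R)
  [I.IsTwoSided]

/-! Grade everything by ℤ/k through the gauge action, with χ the standard character: `T_e` has
degree 1, its adjoint degree -1, and -1 is k - 1 modulo k. Freeness amounts to the function `χ⁻¹ • 1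
= χ^(k-1) • 1` lying in the closed span of the functions `g ↦ a * α g b`. Characters obtained in
this way multiply, `χ⁻¹` generates the dual of ℤ/k, and Fourier inversion then produces every
function supported at one point (`isFreeAction_of_generator_mem`).

If J_E + I_{k-1} is dense, this function is built from degrees. Let `coefficientSpace` at n consist
of those t for which `χ^n • q t` is attained, q being the quotient map onto O_E. It is closed,
stable under left multiplication, and right multiplication by an element of degree m shifts n by m.
Since ⟨e, φ(x) f⟩ = T_e⋆ x T_f, induction puts I_n into the space at n
(`toeplitzLeft_mem_coefficientSpace`). For a in J_E one has a = ψ₁(φ(a)) in O_E, a limit of sums of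
T_e T_f⋆ whose right factor has degree k - 1, so J_E lies in the space at k - 1 as well. By density
so does 1.

Conversely, let ε(t) = ⟨1, t 1⟩ be the vacuum expectation on T_E. It sends the Cuntz-Pimsner ideal
into the closure of J_E, because a - ψ₁(φ(a)) acts as a on the summand A and kills all others
(`fockInner_mem_of_mem_cpIdeal`). If t has degree -1, then t 1 lives in the tensor powers of
exponent n congruent to -1 modulo k, so n ≥ k - 1 and all its inner products lie in I_{k-1}; hence
so does ε(s t) for every s (`vacuumExpectation_mul_sum_gauge_mem`). If the action is free, products
s t of this kind have dense span in O_E, so ε takes all its values in the closure of J_E + I_{k-1}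
(`IsFreeAction.apply_mem`). But ε(a) = a for a in A. -/

theorem Ideal.isOpenQuotientMap_quotientMk : IsOpenQuotientMap (Ideal.Quotient.mk I) :=
  Submodule.isOpenQuotientMap_mkQ I

/-- The quotient of a topological ring by a two-sided ideal is a topological ring. -/
theorem Ideal.isTopologicalRing_quotient : IsTopologicalRing (R ⧸ I) where
  continuous_add := continuous_add
  continuous_neg := continuous_neg
  continuous_mul := by
    have h := I.isOpenQuotientMap_quotientMk
    rw [← (h.prodMap h).continuous_comp_iff]
    exact h.continuous.comp continuous_mul

end QuotientTopology

/-! ### The closed span of the functions `g ↦ a * α g b`. -/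

section FreeAction

/-- A scalar acts as multiplication by its image in the ring. The quotient carries only a ring
topology here, so continuity of scalars has to come from this. -/
theorem continuousConstSMul_of_isTopologicalRing (B : Type*) [Ring B] [Algebra ℂ B]
    [TopologicalSpace B] [IsTopologicalRing B] : ContinuousConstSMul ℂ B where
  continuous_const_smul c := by
    simp only [Algebra.smul_def]
    exact continuous_const_mul _

variable {G B : Type*} [Group G] [Ring B] [Algebra ℂ B] (α : G →* (B →ₐ[ℂ] B))

/-- The linear span of the functions `g ↦ a * α g b`. -/
def actionSpan : Submodule ℂ (G → B) :=
  Submodule.span ℂ {f : G → B | ∃ a b : B, f = fun g => a * α g b}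

variable {α}

theorem mul_apply_mem_actionSpan (a b : B) : (fun g => a * α g b) ∈ actionSpan α :=
  Submodule.subset_span ⟨a, b, rfl⟩

variable [TopologicalSpace B] [IsTopologicalRing B]

/-- Together with the next lemma this makes the closed span a bimodule: `B` acts on the left by
constants and on the right through the coaction `b ↦ (g ↦ α g b)`. -/
theorem mul_mem_closure_actionSpan (a : B) {f : G → B}
    (hf : f ∈ closure (actionSpan α : Set (G → B))) :
    (fun g => a * f g) ∈ closure (actionSpan α : Set (G → B)) := by
  refine map_mem_closure (f := fun (f : G → B) g => a * f g) (by fun_prop) hf fun f hf => ?_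
  have h : actionSpan α ≤ (actionSpan α).comap
      (LinearMap.pi fun g => LinearMap.mulLeft ℂ a ∘ₗ LinearMap.proj g) := by
    refine Submodule.span_le.mpr ?_
    rintro _ ⟨c, b, rfl⟩
    refine Submodule.subset_span ⟨a * c, b, funext fun g => ?_⟩
    simp [mul_assoc]
  exact h hf

theorem mul_apply_mem_closure_actionSpan (b : B) {f : G → B}
    (hf : f ∈ closure (actionSpan α : Set (G → B))) :
    (fun g => f g * α g b) ∈ closure (actionSpan α : Set (G → B)) := by
  refine map_mem_closure (f := fun (f : G → B) g => f g * α g b) (by fun_prop) hf fun f hf => ?_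
  have h : actionSpan α ≤ (actionSpan α).comap
      (LinearMap.pi fun g => LinearMap.mulRight ℂ (α g b) ∘ₗ LinearMap.proj g) := by
    refine Submodule.span_le.mpr ?_
    rintro _ ⟨a, c, rfl⟩
    refine Submodule.subset_span ⟨a, c * b, funext fun g => ?_⟩
    simp [mul_assoc]
  exact h hf

/-- The scalar can be moved inside, `χ g • (a * α g b) = a * (χ g • 1) * α g b`, and the bimodule
structure applies. It follows that the scalar functions whose multiples of 1 are attained are closed
under products. -/
theorem smul_mem_closure_actionSpan {χ : G → ℂ}
    (hχ : (fun g => χ g • (1 : B)) ∈ closure (actionSpan α : Set (G → B))) {f : G → B}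
    (hf : f ∈ closure (actionSpan α : Set (G → B))) :
    (fun g => χ g • f g) ∈ closure (actionSpan α : Set (G → B)) := by
  have _ := continuousConstSMul_of_isTopologicalRing B
  let L : (G → B) →ₗ[ℂ] (G → B) := LinearMap.pi fun g => χ g • LinearMap.proj g
  have hL : Continuous L := continuous_pi fun g => (continuous_apply g).const_smul (χ g)
  have h : actionSpan α ≤ (actionSpan α).topologicalClosure.comap L := by
    refine Submodule.span_le.mpr ?_
    rintro _ ⟨a, b, rfl⟩
    have h1 := mul_apply_mem_closure_actionSpan b (mul_mem_closure_actionSpan a hχ)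
    change (fun g => χ g • (a * α g b)) ∈ closure (actionSpan α : Set (G → B))
    simpa using h1
  exact closure_minimal (t := L ⁻¹' closure (actionSpan α : Set (G → B))) h
    (isClosed_closure.preimage hL) hf

end FreeAction

/-! ### Characters of ℤ/k and freeness. -/

section ZModCharacter

variable {k : ℕ} [NeZero k]

theorem ZMod.toCircle_pow_card (j : ZMod k) : ZMod.toCircle j ^ k = 1 := by
  rw [← AddChar.map_nsmul_eq_pow]
  simp

theorem ZMod.coe_toCircle_pow_card (j : ZMod k) : (ZMod.toCircle j : ℂ) ^ k = 1 := by
  rw [← Circle.coe_pow, toCircle_pow_card, Circle.coe_one]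

/-- Degree -1 is recorded as degree k - 1, so that all exponents stay natural numbers. -/
theorem ZMod.coe_toCircle_inv_eq_pow (j : ZMod k) :
    (ZMod.toCircle j : ℂ)⁻¹ = (ZMod.toCircle j : ℂ) ^ (k - 1) := by
  refine inv_eq_of_mul_eq_one_left ?_
  rw [← pow_succ, Nat.sub_add_cancel NeZero.one_le, coe_toCircle_pow_card]

/-- Translation by 1 multiplies the sum by χ(1)^n, which differs from 1 because χ is injective and n
is nonzero in ℤ/k. -/
theorem ZMod.sum_toCircle_pow_eq_zero {n : ℕ} (hn : ¬ k ∣ n) :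
    ∑ j : ZMod k, (ZMod.toCircle j : ℂ) ^ n = 0 := by
  have h1 : (ZMod.toCircle (1 : ZMod k) : ℂ) ^ n ≠ 1 := by
    rw [← Circle.coe_pow, Ne, Circle.coe_eq_one, ← AddChar.map_nsmul_eq_pow,
      ← AddChar.map_zero_eq_one (ZMod.toCircle (N := k)), ZMod.injective_toCircle.eq_iff,
      nsmul_eq_mul, mul_one, ZMod.natCast_eq_zero_iff]
    exact hn
  have h2 : (ZMod.toCircle (1 : ZMod k) : ℂ) ^ n * ∑ j : ZMod k, (ZMod.toCircle j : ℂ) ^ n =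
      ∑ j : ZMod k, (ZMod.toCircle j : ℂ) ^ n := by
    rw [Finset.mul_sum, ← Equiv.sum_comp (Equiv.addLeft (1 : ZMod k))
      fun j => (ZMod.toCircle j : ℂ) ^ n]
    refine Finset.sum_congr rfl fun j _ => ?_
    rw [Equiv.coe_addLeft, AddChar.map_add_eq_mul, Circle.coe_mul, mul_pow]
  have h3 := sub_eq_zero.mpr h2
  rw [← sub_one_mul] at h3
  exact (mul_eq_zero.mp h3).resolve_left (sub_ne_zero.mpr h1)

/-- Orthogonality in the form needed for Fourier inversion: the sum runs over the exponents n and is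
geometric, its ratio being a k-th root of unity. -/
theorem ZMod.sum_range_toCircle_pow (i j : ZMod k) :
    ∑ n ∈ Finset.range k, ((ZMod.toCircle i : ℂ)⁻¹) ^ n * (ZMod.toCircle j : ℂ) ^ n =
      if j = i then (k : ℂ) else 0 := by
  have h0 : (ZMod.toCircle i : ℂ) ≠ 0 := Circle.coe_ne_zero _
  split_ifs with h
  · subst h
    simp
  · have h1 : (ZMod.toCircle i : ℂ)⁻¹ * (ZMod.toCircle j : ℂ) ≠ 1 := fun h2 => h <| by
      rw [inv_mul_eq_one₀ h0] at h2
      exact (ZMod.injective_toCircle (Circle.ext h2)).symm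
    simp only [← mul_pow]
    rw [geom_sum_eq h1, mul_pow, inv_pow, coe_toCircle_pow_card, coe_toCircle_pow_card]
    simp

variable {B : Type*} [Ring B] [Algebra ℂ B] [TopologicalSpace B] [IsTopologicalRing B]
  {α : Multiplicative (ZMod k) →* (B →ₐ[ℂ] B)}

/-- An action of `ℤ/k` is free if a generator of the dual group lies in the closed span of the
functions `g ↦ a * α g b`. -/
theorem isFreeAction_of_generator_mem
    (h : (fun g : Multiplicative (ZMod k) => (ZMod.toCircle g.toAdd : ℂ) ^ (k - 1) • (1 : B)) ∈
      closure (actionSpan α : Set (Multiplicative (ZMod k) → B))) : IsFreeAction α := by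
  have _ := continuousConstSMul_of_isTopologicalRing B
  have hpow : ∀ n : ℕ, (fun g : Multiplicative (ZMod k) =>
      ((ZMod.toCircle g.toAdd : ℂ)⁻¹) ^ n • (1 : B)) ∈ (actionSpan α).topologicalClosure := by
    intro n
    change _ ∈ closure (actionSpan α : Set (Multiplicative (ZMod k) → B))
    induction n with
    | zero => simpa using subset_closure (mul_apply_mem_actionSpan (α := α) 1 1)
    | succ n ih =>
      -- The hypothesis `h` is the case of the single factor χ⁻¹, written as χ^(k-1).
      have h1 := smul_mem_closure_actionSpan h ih
      simpa only [smul_smul, ← ZMod.coe_toCircle_inv_eq_pow, ← pow_succ'] using h1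
  have hsingle : ∀ (i : Multiplicative (ZMod k)) (b : B),
      Pi.single i b ∈ (actionSpan α).topologicalClosure := by
    intro i b
    -- Fourier inversion: the point mass at i is k⁻¹ ∑ χ(i)^n χ⁻ⁿ over n < k, and b enters as a
    -- constant left factor.
    have h1 : (Pi.single i b : Multiplicative (ZMod k) → B) = ∑ n ∈ Finset.range k,
        ((k : ℂ)⁻¹ * (ZMod.toCircle i.toAdd : ℂ) ^ n) • fun g : Multiplicative (ZMod k) =>
          b * ((ZMod.toCircle g.toAdd : ℂ)⁻¹) ^ n • (1 : B) := by
      funext g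
      have h2 := ZMod.sum_range_toCircle_pow g.toAdd i.toAdd
      have hk : (k : ℂ) ≠ 0 := NeZero.ne _
      simp only [Finset.sum_apply, Pi.smul_apply, mul_smul_comm, mul_one, smul_smul]
      rw [← Finset.sum_smul]
      have h3 : ∑ n ∈ Finset.range k, (k : ℂ)⁻¹ * (ZMod.toCircle i.toAdd : ℂ) ^ n *
          ((ZMod.toCircle g.toAdd : ℂ)⁻¹) ^ n = if g = i then 1 else 0 := by
        simp only [mul_assoc, ← Finset.mul_sum]
        simp only [mul_comm ((ZMod.toCircle i.toAdd : ℂ) ^ _)]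
        rw [h2]
        by_cases hgi : g = i
        · simp [hgi, hk]
        · rw [if_neg hgi, if_neg fun h4 => hgi (Multiplicative.toAdd.injective h4).symm, mul_zero]
      rw [h3, Pi.single_apply]
      split_ifs <;> simp
    rw [h1]
    exact Submodule.sum_mem _ fun n _ => Submodule.smul_mem _ _
      (mul_mem_closure_actionSpan b (hpow n))
  intro f
  change f ∈ (actionSpan α).topologicalClosure
  classical
  rw [← Finset.univ_sum_single f]
  exact Submodule.sum_mem _ fun i _ => hsingle i (f i)

/-! ### Degrees upstairs, along an equivariant quotient map. -/

section Equivariant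

variable {R : Type*} [Ring R] [Algebra ℂ R] {q : R →ₐ[ℂ] B} {β : ZMod k → R →ₐ[ℂ] R}

/-- The elements `t` for which the function `g ↦ χ(g) ^ n q(t)`, with `χ` the standard character of
`ℤ/k`, lies in the closed span of the functions `g ↦ a * α g b`. -/
noncomputable def coefficientSpace (α : Multiplicative (ZMod k) →* (B →ₐ[ℂ] B)) (q : R →ₐ[ℂ] B)
    (n : ℕ) : Submodule ℂ R :=
  have _ := continuousConstSMul_of_isTopologicalRing B
  (actionSpan α).topologicalClosure.comap (LinearMap.pi fun g : Multiplicative (ZMod k) =>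
    (ZMod.toCircle g.toAdd : ℂ) ^ n • q.toLinearMap)

variable {n m : ℕ}

theorem mem_coefficientSpace {t : R} : t ∈ coefficientSpace α q n ↔
    (fun g : Multiplicative (ZMod k) => (ZMod.toCircle g.toAdd : ℂ) ^ n • q t) ∈
      closure (actionSpan α : Set (Multiplicative (ZMod k) → B)) := Iff.rfl

theorem isClosed_coefficientSpace [TopologicalSpace R] (hq : Continuous q) :
    IsClosed (coefficientSpace α q n : Set R) := by
  have _ := continuousConstSMul_of_isTopologicalRing B
  exact isClosed_closure.preimage (continuous_pi fun g => hq.const_smul _)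

theorem mem_coefficientSpace_zero (t : R) : t ∈ coefficientSpace α q 0 := by
  rw [mem_coefficientSpace]
  simpa using subset_closure (mul_apply_mem_actionSpan (α := α) (q t) 1)

theorem mul_mem_coefficientSpace (s : R) {t : R} (ht : t ∈ coefficientSpace α q n) :
    s * t ∈ coefficientSpace α q n := by
  have h := mul_mem_closure_actionSpan (q s) ht
  rw [mem_coefficientSpace]
  simpa using h

/-- If s has degree m, then `α g (q s) = χ(g)^m • q s`, so multiplying `χ^n • q t` on the right
through the coaction raises the exponent by m. -/
theorem mul_mem_coefficientSpace_add (hα : ∀ g t, α g (q t) = q (β g.toAdd t)) {s t : R}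
    (ht : t ∈ coefficientSpace α q n)
    (hs : ∀ j, β j s = (ZMod.toCircle j : ℂ) ^ m • s) :
    t * s ∈ coefficientSpace α q (n + m) := by
  have h := mul_apply_mem_closure_actionSpan (q s) ht
  rw [mem_coefficientSpace]
  simpa [hα, hs, smul_smul, pow_add, mul_comm] using h

/-- If a functional that factors through the quotient map `q` modulo a closed subspace `M`
vanishes modulo `M` on the products `s t` with `t` of degree `-1`, then it vanishes modulo `M`
whenever the action is free. -/
theorem IsFreeAction.apply_mem [TopologicalSpace R] (h : IsFreeAction α)
    (hα : ∀ g t, α g (q t) = q (β g.toAdd t)) (hq : IsOpenQuotientMap q)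
    {V : Type*} [AddCommGroup V] [Module ℂ V] [TopologicalSpace V] {M : Submodule ℂ V}
    (hM : IsClosed (M : Set V)) {ε : R →ₗ[ℂ] V} (hε : Continuous ε)
    (hker : ∀ t, q t = 0 → ε t ∈ M)
    (hmul : ∀ s t, ε (s * ∑ j, (ZMod.toCircle j : ℂ) • β j t) ∈ M) (t : R) : ε t ∈ M := by
  have _ := continuousConstSMul_of_isTopologicalRing B
  -- `S` is the set of classes in `B` on which ε takes values in `M`; this is well defined because
  -- `hker` makes ε modulo `M` factor through q.
  let S : Submodule ℂ B := (M.comap ε).map q.toLinearMap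
  have hmem : ∀ t, q t ∈ S ↔ ε t ∈ M := by
    refine fun t => ⟨?_, fun ht => ⟨t, ht, rfl⟩⟩
    rintro ⟨s, hs, hst⟩
    have h2 : ε (s - t) ∈ M := hker _ (by rw [map_sub]; exact sub_eq_zero.mpr hst)
    rw [map_sub] at h2
    exact (Submodule.sub_mem_iff_right M hs).mp h2
  -- The preimage of `S` under the quotient map is ε⁻¹(M), which is closed.
  have hS : IsClosed (S : Set B) := by
    rw [← hq.isQuotientMap.isClosed_preimage]
    convert hM.preimage hε using 1
    exact Set.ext hmem
  -- Up to the factor k, `L` extracts the Fourier coefficient at χ⁻¹. On `g ↦ q s * α g (q t)` it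
  -- gives q of s times k times the degree -1 part of t, which is what `hmul` controls.
  let L : (Multiplicative (ZMod k) → B) →ₗ[ℂ] B :=
    ∑ j : ZMod k, (ZMod.toCircle j : ℂ) • LinearMap.proj (Multiplicative.ofAdd j)
  have hL : ∀ f, L f = ∑ j : ZMod k, (ZMod.toCircle j : ℂ) • f (Multiplicative.ofAdd j) :=
    fun f => by simp [L]
  have hLc : Continuous L := by
    rw [show (L : _ → _) = _ from funext hL]
    exact continuous_finsetSum _ fun j _ => (continuous_apply _).const_smul _
  have hspan : actionSpan α ≤ S.comap L := by
    refine Submodule.span_le.mpr ?_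
    rintro _ ⟨a, b, rfl⟩
    obtain ⟨s, rfl⟩ := hq.surjective a
    obtain ⟨t, rfl⟩ := hq.surjective b
    have h1 : L (fun g => q s * α g (q t)) =
        q (s * ∑ j, (ZMod.toCircle j : ℂ) • β j t) := by
      simp [hL, hα, Finset.mul_sum]
    rw [SetLike.mem_coe, Submodule.mem_comap, h1, hmem]
    exact hmul s t
  -- Freeness is used for one function only: χ⁻¹ q(t), which `L` sends to k q(t).
  have h1 : L (fun g => (ZMod.toCircle g.toAdd : ℂ)⁻¹ • q t) ∈ S :=
    closure_minimal hspan (hS.preimage hLc) (h _)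
  have h2 : L (fun g => (ZMod.toCircle g.toAdd : ℂ)⁻¹ • q t) = (k : ℂ) • q t := by
    rw [hL]
    simp [smul_smul, Nat.cast_smul_eq_nsmul]
  rwa [h2, Submodule.smul_mem_iff _ (NeZero.ne (k : ℂ)), hmem] at h1

end Equivariant

end ZModCharacter

namespace CStarCorrespondence

open MulOpposite

variable {A E : Type*} [CStarAlgebra A] [PartialOrder A] [StarOrderedRing A]
  [NormedAddCommGroup E] [NormedSpace ℂ E] [Module Aᵐᵒᵖ E] [CStarModule Aᵐᵒᵖ E]
  (X : CStarCorrespondence A E)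

/-! ### The ideals I_n and J_E. -/

section Ideals

/-- An adjointable operator is automatically right `A`-linear: move it to the other side of the
inner product. -/
theorem φ_op_smul (x a : A) (e : E) : X.φ x (op a • e) = op a • X.φ x e := by
  refine ext_rightInner (A := A) fun u => ?_
  have h : ∀ v, rightInner A u (X.φ x v) = rightInner A (X.φ (star x) u) v := fun v => by
    rw [X.inner_φ, star_star]
  rw [h, rightInner_op_smul_right, rightInner_op_smul_right, h]

theorem rightInner_φ_mem_innerIdeal {n : ℕ} {x : A} (hx : x ∈ X.innerIdeal n) (e f : E) :
    rightInner A e (X.φ x f) ∈ X.innerIdeal (n + 1) := by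
  cases n with
  | zero => exact Submodule.le_topologicalClosure _ (Submodule.subset_span ⟨e, X.φ x f, rfl⟩)
  | succ n => exact Submodule.le_topologicalClosure _ (Submodule.subset_span ⟨e, f, x, hx, rfl⟩)

/-- Every closed subspace containing the elements `⟨e, φ(x) f⟩` with `x` in `I_n` contains
`I_{n+1}`. -/
theorem innerIdeal_succ_le {n : ℕ} {S : Submodule ℂ A} (hS : IsClosed (S : Set A))
    (h : ∀ e f : E, ∀ x ∈ X.innerIdeal n, rightInner A e (X.φ x f) ∈ S) :
    X.innerIdeal (n + 1) ≤ S := by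
  cases n with
  | zero =>
    refine Submodule.topologicalClosure_minimal _ (Submodule.span_le.mpr ?_) hS
    rintro _ ⟨e, f, rfl⟩
    -- I_1 fits the general recursion because ⟨e, f⟩ = ⟨e, φ(1) f⟩ and 1 lies in I_0 = A.
    simpa using h e f 1 Submodule.mem_top
  | succ n =>
    refine Submodule.topologicalClosure_minimal _ (Submodule.span_le.mpr ?_) hS
    rintro _ ⟨e, f, x, hx, rfl⟩
    exact h e f x hx

theorem isClosed_innerIdeal (n : ℕ) : IsClosed (X.innerIdeal n : Set A) := by
  match n with
  | 0 => exact isClosed_univ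
  | 1 => exact Submodule.isClosed_topologicalClosure _
  | _ + 2 => exact Submodule.isClosed_topologicalClosure _

theorem innerIdeal_antitone : Antitone X.innerIdeal := by
  refine antitone_nat_of_succ_le fun n => ?_
  induction n with
  | zero => exact le_top
  | succ n ih =>
    exact X.innerIdeal_succ_le (X.isClosed_innerIdeal _) fun e f x hx =>
      X.rightInner_φ_mem_innerIdeal (ih hx) e f

/-- Outer factors are absorbed into the vectors: a⟨e, φ(y) f⟩b = ⟨e a⋆, φ(y)(f b)⟩. -/
theorem mul_mul_mem_innerIdeal {n : ℕ} (a b : A) {x : A} (hx : x ∈ X.innerIdeal n) :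
    a * x * b ∈ X.innerIdeal n := by
  cases n with
  | zero => exact Submodule.mem_top
  | succ n =>
    have h : X.innerIdeal (n + 1) ≤
        (X.innerIdeal (n + 1)).comap (LinearMap.mulLeftRight ℂ (a, b)) := by
      refine X.innerIdeal_succ_le ?_ fun e f y hy => ?_
      · exact (X.isClosed_innerIdeal _).preimage
          (f := fun x => a * x * b) (by fun_prop)
      · have h1 := X.rightInner_φ_mem_innerIdeal hy (op (star a) • e) (op b • f)
        rw [φ_op_smul, rightInner_op_smul_left, rightInner_op_smul_right, star_star,
          ← mul_assoc] at h1
        exact h1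
    exact h hx

/-- Contracting one pair of letters replaces c by ⟨e, φ(c) f⟩ and raises the index by one; words of
different lengths give 0. -/
theorem wordInner_mem_innerIdeal {n : ℕ} {c : A} (hc : c ∈ X.innerIdeal n) (w v : List E) :
    X.wordInner c w v ∈ X.innerIdeal (n + v.length) := by
  induction w generalizing n c v with
  | nil =>
    cases v with
    | nil => exact hc
    | cons f v => exact Submodule.zero_mem _
  | cons e w ih =>
    cases v with
    | nil => exact Submodule.zero_mem _
    | cons f v =>
      have h := ih (X.rightInner_φ_mem_innerIdeal hc e f) v
      rwa [Nat.add_right_comm, Nat.add_assoc] at h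

theorem φ_mul_mem_compacts (a : A) {T : E →L[ℂ] E} (hT : T ∈ compacts A E) :
    X.φ a * T ∈ compacts A E := by
  have h : compacts A E ≤ (compacts A E).comap (LinearMap.mulLeft ℂ (X.φ a)) := by
    refine Submodule.topologicalClosure_minimal _ (Submodule.span_le.mpr ?_)
      ((Submodule.isClosed_topologicalClosure _).preimage (continuous_const_mul (X.φ a)))
    rintro _ ⟨⟨e, f⟩, rfl⟩
    refine Submodule.le_topologicalClosure _ (Submodule.subset_span ⟨(X.φ a e, f), ?_⟩)
    refine ContinuousLinearMap.ext fun g => ?_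
    exact (X.φ_op_smul a _ e).symm
  exact h hT

theorem mul_φ_mem_compacts (a : A) {T : E →L[ℂ] E} (hT : T ∈ compacts A E) :
    T * X.φ a ∈ compacts A E := by
  have h : compacts A E ≤ (compacts A E).comap (LinearMap.mulRight ℂ (X.φ a)) := by
    refine Submodule.topologicalClosure_minimal _ (Submodule.span_le.mpr ?_)
      ((Submodule.isClosed_topologicalClosure _).preimage (continuous_mul_const (X.φ a)))
    rintro _ ⟨⟨e, f⟩, rfl⟩
    refine Submodule.le_topologicalClosure _ (Submodule.subset_span ⟨(e, X.φ (star a) f), ?_⟩)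
    refine ContinuousLinearMap.ext fun g => ?_
    change op (rightInner A (X.φ (star a) f) g) • e = op (rightInner A f (X.φ a g)) • e
    rw [X.inner_φ, star_star]
  exact h hT

/-- The compacts absorb φ(A) on both sides. For the orthogonality, ker φ is an ideal, so bc and ca
stay in it when c does. -/
theorem mul_mul_mem_katsuraIdeal (a b : A) {x : A} (hx : x ∈ X.katsuraIdeal) :
    a * x * b ∈ X.katsuraIdeal := by
  refine ⟨?_, fun c hc => ⟨?_, ?_⟩⟩
  · rw [map_mul, map_mul]
    exact X.mul_φ_mem_compacts b (X.φ_mul_mem_compacts a hx.1)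
  · have h := (hx.2 (b * c) (by rw [map_mul, hc, mul_zero])).1
    rw [mul_assoc, mul_assoc, h, mul_zero]
  · have h := (hx.2 (c * a) (by rw [map_mul, hc, zero_mul])).2
    rw [← mul_assoc, ← mul_assoc, h, zero_mul]

end Ideals

/-! ### Matrix coefficients on the Fock module. -/

section FockInner

/-- The inner product `η ↦ ⟨ξ, η⟩` of the Fock module with a vector of the algebraic Fock module. -/
noncomputable def fockInner (ξ : X.PreFock) : X.Fock →L[ℂ] A :=
  ((X.preInner 1 ξ).mkContinuous ‖ξ‖ (X.norm_preInner_le ξ)).extend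
    UniformSpace.Completion.toComplL

theorem fockInner_coe (ξ η : X.PreFock) : X.fockInner ξ (η : X.Fock) = X.preInner 1 ξ η :=
  ContinuousLinearMap.extend_eq _ UniformSpace.Completion.denseRange_coe
    (UniformSpace.Completion.isUniformInducing_coe _) η

theorem fockInner_vec (ξ : X.PreFock) (w : List E) (x : A) :
    X.fockInner ξ (X.vec w x) = X.preInner 1 ξ (X.word w x) :=
  X.fockInner_coe ξ _

/-- A closed subspace of the Fock module that contains the vectors `e₁ ⊗ ⋯ ⊗ eₙ x` is everything. -/
theorem fock_induction {p : X.Fock → Prop} (hp : IsClosed {η | p η}) (h0 : p 0)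
    (hadd : ∀ ξ η, p ξ → p η → p (ξ + η)) (hvec : ∀ w x, p (X.vec w x)) (η : X.Fock) : p η := by
  refine UniformSpace.Completion.induction_on η hp fun ξ => ?_
  refine X.word_induction (p := fun ξ : X.PreFock => p (ξ : X.Fock)) ?_ (fun w x ξ hξ => ?_) ξ
  · rwa [UniformSpace.Completion.coe_zero]
  · rw [UniformSpace.Completion.coe_add]
    exact hadd _ _ (hvec w x) hξ

theorem fockInner_comp_eq {ξ ζ : X.PreFock} {T : X.Fock →L[ℂ] X.Fock}
    {S : X.PreFock →ₗ[ℂ] X.PreFock} (hT : ∀ η : X.PreFock, T (η : X.Fock) = (S η : X.PreFock))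
    (h : ∀ η, X.preInner 1 ξ (S η) = X.preInner 1 ζ η) (η : X.Fock) :
    X.fockInner ξ (T η) = X.fockInner ζ η := by
  refine UniformSpace.Completion.induction_on η (isClosed_eq (by fun_prop) (by fun_prop))
    fun η => ?_
  rw [hT, fockInner_coe, fockInner_coe, h]

/-- The operators in the algebra generated by `A`, the creation and the annihilation operators
have formal adjoints on the algebraic Fock module. -/
theorem exists_formal_adjoint {T : X.Fock →L[ℂ] X.Fock}
    (hT : T ∈ Algebra.adjoin ℂ
      (Set.range X.left ∪ Set.range X.create ∪ Set.range X.annihilate)) (ξ : X.PreFock) :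
    ∃ ζ : X.PreFock, ∀ η, X.fockInner ξ (T η) = X.fockInner ζ η := by
  have hadd : ∀ (ξ ζ : X.PreFock) (η : X.Fock),
      X.fockInner (ξ + ζ) η = X.fockInner ξ η + X.fockInner ζ η := fun ξ ζ η => by
    refine UniformSpace.Completion.induction_on η (isClosed_eq (by fun_prop) (by fun_prop))
      fun η => ?_
    simp [fockInner_coe]
  induction hT using Algebra.adjoin_induction generalizing ξ with
  | mem T hT =>
    rcases hT with (⟨a, rfl⟩ | ⟨e, rfl⟩) | ⟨e, rfl⟩
    · refine ⟨X.preLeft (star a) ξ, X.fockInner_comp_eq (X.left_coe a) fun η => ?_⟩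
      rw [preInner_preLeft, preInner_preLeft_left, star_star, one_mul, mul_one]
    · refine ⟨X.preAnnihilate e ξ, X.fockInner_comp_eq (X.create_coe e) fun η => ?_⟩
      rw [← star_star (X.preInner 1 ξ _), star_preInner, star_one, preInner_preAnnihilate,
        star_preInner, star_one]
    · exact ⟨X.preCreate e ξ, X.fockInner_comp_eq (X.annihilate_coe e) fun η =>
        (X.preInner_preAnnihilate e ξ η).symm⟩
  | algebraMap r =>
    refine ⟨star r • ξ, X.fockInner_comp_eq (S := r • LinearMap.id) (fun η => ?_) fun η => ?_⟩
    · simp [Algebra.algebraMap_eq_smul_one, UniformSpace.Completion.coe_smul]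
    · simp
  | add S T _ _ hS hT =>
    obtain ⟨ζ, hζ⟩ := hS ξ
    obtain ⟨ζ', hζ'⟩ := hT ξ
    refine ⟨ζ + ζ', fun η => ?_⟩
    rw [add_apply, map_add, hζ, hζ', hadd]
  | mul S T _ _ hS hT =>
    obtain ⟨ζ, hζ⟩ := hS ξ
    obtain ⟨ζ', hζ'⟩ := hT ζ
    refine ⟨ζ', fun η => ?_⟩
    rw [mul_apply_eq_comp, hζ, hζ']

/-- If all inner products of `η` with vectors of the algebraic Fock module lie in a closed
subspace of `A`, then so do those of its images under the Toeplitz algebra. -/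
theorem fockInner_apply_mem {S : Submodule ℂ A} (hS : IsClosed (S : Set A)) {η : X.Fock}
    (h : ∀ ξ, X.fockInner ξ η ∈ S) {T : X.Fock →L[ℂ] X.Fock} (hT : T ∈ X.toeplitz)
    (ξ : X.PreFock) : X.fockInner ξ (T η) ∈ S := by
  have hc : Continuous fun T : X.Fock →L[ℂ] X.Fock => X.fockInner ξ (T η) := by fun_prop
  -- For T in the generated algebra a formal adjoint moves T onto ξ, which stays algebraic, so the
  -- hypothesis on η applies. General T follow by continuity.
  refine closure_minimal (fun T hT => ?_) (hS.preimage hc) hT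
  obtain ⟨ζ, hζ⟩ := X.exists_formal_adjoint hT ξ
  change X.fockInner ξ (T η) ∈ S
  rw [hζ]
  exact h ζ

theorem fockInner_vec_mem {S : Submodule ℂ A} {w : List E} {x : A}
    (h : ∀ v y, star y * X.wordInner 1 v w * x ∈ S) (ξ : X.PreFock) :
    X.fockInner ξ (X.vec w x) ∈ S := by
  rw [fockInner_vec]
  refine X.word_induction (p := fun ξ => X.preInner 1 ξ (X.word w x) ∈ S) (by simp)
    (fun v y ξ hξ => ?_) ξ
  rw [map_add, LinearMap.add_apply, preInner_word]
  exact S.add_mem (h v y) hξ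

end FockInner

/-! ### Toeplitz relations and the Cuntz-Pimsner ideal. -/

section Toeplitz

theorem norm_left_le (a : A) : ‖X.left a‖ ≤ ‖a‖ := by
  refine ContinuousLinearMap.opNorm_le_bound _ (norm_nonneg _) fun ξ => ?_
  refine UniformSpace.Completion.induction_on ξ
    (isClosed_le (by fun_prop) (by fun_prop)) fun ξ => ?_
  rw [left_coe, UniformSpace.Completion.norm_coe, UniformSpace.Completion.norm_coe]
  exact X.norm_preLeft_le a ξ

theorem norm_create_le (e : E) : ‖X.create e‖ ≤ ‖e‖ := by
  refine ContinuousLinearMap.opNorm_le_bound _ (norm_nonneg _) fun ξ => ?_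
  refine UniformSpace.Completion.induction_on ξ
    (isClosed_le (by fun_prop) (by fun_prop)) fun ξ => ?_
  rw [create_coe, UniformSpace.Completion.norm_coe, UniformSpace.Completion.norm_coe]
  exact X.norm_preCreate_le e ξ

theorem continuous_create : Continuous X.create :=
  (LinearMap.mkContinuous (σ := RingHom.id ℂ)
    { toFun := X.create, map_add' := X.create_add, map_smul' := X.create_smul } 1
    fun e => (X.norm_create_le e).trans_eq (one_mul _).symm).continuous

theorem left_add (a b : A) : X.left (a + b) = X.left a + X.left b := by
  refine X.fock_ext fun w x => ?_
  rw [add_apply]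
  rcases w with _ | ⟨f, w⟩
  · rw [left_vec_nil, left_vec_nil, left_vec_nil, add_mul, vec, map_add,
      UniformSpace.Completion.coe_add, vec, vec]
  · rw [left_vec_cons, left_vec_cons, left_vec_cons, map_add, add_apply, ← create_vec, create_add,
      add_apply, create_vec, create_vec]

/-- The inclusion of `A` into the Toeplitz algebra as a continuous linear map. -/
noncomputable def toeplitzLeftL : A →L[ℂ] X.toeplitz :=
  LinearMap.mkContinuous
    { toFun := X.toeplitzLeft
      map_add' := fun a b => Subtype.ext (X.left_add a b)
      map_smul' := fun r a => Subtype.ext (X.left_smul r a) } 1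
    fun a => (X.norm_left_le a).trans_eq (one_mul _).symm

theorem toeplitzLeftL_apply (a : A) : X.toeplitzLeftL a = X.toeplitzLeft a := rfl

theorem left_one : X.left 1 = 1 := by
  refine X.fock_ext fun w x => ?_
  rcases w with _ | ⟨f, w⟩
  · rw [left_vec_nil, one_mul]; rfl
  · rw [left_vec_cons, map_one]; rfl

theorem left_mul_create (a : A) (e : E) : X.left a * X.create e = X.create (X.φ a e) := by
  refine X.fock_ext fun w x => ?_
  rw [mul_apply_eq_comp, create_vec, left_vec_cons, create_vec]

/-- The creation operator as an element of the Toeplitz algebra. -/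
noncomputable def toeplitzCreate (e : E) : X.toeplitz := ⟨X.create e, X.create_mem e⟩

/-- The annihilation operator as an element of the Toeplitz algebra. -/
noncomputable def toeplitzAnnihilate (e : E) : X.toeplitz := ⟨X.annihilate e, X.annihilate_mem e⟩

/-- This Toeplitz relation reproduces the recursion that defines the ideals I_n. -/
theorem toeplitzAnnihilate_mul_left_mul_create (e f : E) (x : A) :
    X.toeplitzAnnihilate e * X.toeplitzLeft x * X.toeplitzCreate f =
      X.toeplitzLeft (rightInner A e (X.φ x f)) := by
  refine Subtype.ext ?_
  change X.annihilate e * X.left x * X.create f = X.left _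
  rw [mul_assoc, left_mul_create, annihilate_mul_create]

theorem toeplitzGauge_create (z : Circle) (e : E) :
    X.toeplitzGauge z (X.toeplitzCreate e) = (z : ℂ) • X.toeplitzCreate e :=
  Subtype.ext ((X.conj_eq (X.gaugeUnitary_mul_create z e)).trans (X.create_smul _ e))

theorem toeplitzGauge_annihilate (z : Circle) (e : E) :
    X.toeplitzGauge z (X.toeplitzAnnihilate e) = (z : ℂ)⁻¹ • X.toeplitzAnnihilate e := by
  refine Subtype.ext ((X.conj_eq (X.gaugeUnitary_mul_annihilate z e)).trans ?_)
  rw [annihilate_smul, Complex.star_def, ← Circle.coe_inv_eq_conj, Circle.coe_inv]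
  rfl

/-- The operator ψ₁(k) acts as k ⊗ 1 on the positive tensor powers and as 0 on A. Both identities
are closed conditions, so they pass from the span of the rank one pairs to its closure. -/
theorem psiGraph_spec {p : (E →L[ℂ] E) × (X.Fock →L[ℂ] X.Fock)} (hp : p ∈ X.psiGraph) :
    (∀ f, p.2 * X.create f = X.create (p.1 f)) ∧ ∀ x, p.2 (X.vec [] x) = 0 := by
  have hc := X.continuous_create
  constructor
  · intro f
    exact closure_minimal
      (t := {p : (E →L[ℂ] E) × (X.Fock →L[ℂ] X.Fock) | p.2 * X.create f = X.create (p.1 f)})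
      (fun p hp => (X.psi_spec hp).2.1 f) (isClosed_eq (by fun_prop) (by fun_prop)) hp
  · intro x
    exact closure_minimal
      (t := {p : (E →L[ℂ] E) × (X.Fock →L[ℂ] X.Fock) | p.2 (X.vec [] x) = 0})
      (fun p hp => (X.psi_spec hp).2.2.1 x) (isClosed_eq (by fun_prop) (by fun_prop)) hp

variable [CompleteSpace E]

theorem psi_mem_psiGraph (k : compacts A E) : (k.1, (X.psi k).1) ∈ X.psiGraph :=
  (X.psi_existsUnique k).choose_spec.1

/-- The matrix coefficients of the elements of the Cuntz-Pimsner ideal lie in the closure of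
Katsura's ideal. -/
theorem fockInner_mem_of_mem_cpIdeal {t : X.toeplitz} (ht : t ∈ X.cpIdeal) (ξ : X.PreFock)
    (η : X.Fock) : X.fockInner ξ (t.1 η) ∈ X.katsuraIdeal.topologicalClosure := by
  have hJ : IsClosed (X.katsuraIdeal.topologicalClosure : Set A) :=
    Submodule.isClosed_topologicalClosure _
  have hc : Continuous fun t : X.toeplitz => X.fockInner ξ (t.1 η) := by fun_prop
  refine closure_minimal (fun t ht => ?_) (hJ.preimage hc) ht
  change X.fockInner ξ (t.1 η) ∈ X.katsuraIdeal.topologicalClosure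
  have ht' := TwoSidedIdeal.mem_asIdeal.mp ht
  clear hc ht
  -- Both ξ and η must vary: a left factor is moved onto ξ by adjoints and limits, a right factor is
  -- applied to η.
  induction ht' using TwoSidedIdeal.span_induction generalizing ξ η with
  | mem t ht =>
    obtain ⟨a, ha, rfl⟩ := ht
    obtain ⟨h1, h2⟩ := X.psiGraph_spec (X.psi_mem_psiGraph ⟨X.φ a, ha.1⟩)
    have h3 : ∀ η, (X.toeplitzLeft a - X.psi ⟨X.φ a, ha.1⟩ : X.toeplitz).1 η =
        X.left a η - (X.psi ⟨X.φ a, ha.1⟩).1 η := fun η => rfl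
    simp only [h3]
    refine X.fock_induction (p := fun η => X.fockInner ξ (X.left a η -
      (X.psi ⟨X.φ a, ha.1⟩).1 η) ∈ X.katsuraIdeal.topologicalClosure) ?_ ?_ ?_ ?_ η
    · exact hJ.preimage (by fun_prop)
    · simp
    · intro η η' h h'
      have := Submodule.add_mem _ h h'
      rwa [← map_add, sub_add_sub_comm, ← map_add, ← map_add] at this
    · intro w x
      rcases w with _ | ⟨f, w⟩
      -- On the summand A only the term of a survives, and its coefficients lie in J_E because J_E
      -- is an ideal.
      · rw [h2, left_vec_nil, sub_zero]
        refine X.fockInner_vec_mem (fun v y => ?_) ξ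
        rw [← mul_assoc]
        exact Submodule.le_topologicalClosure _ (X.mul_mul_mem_katsuraIdeal _ x ha)
      -- On f ⊗ w both terms create φ(a) f, so they cancel.
      · rw [← create_vec, ← mul_apply_eq_comp, ← mul_apply_eq_comp, h1, left_mul_create, sub_self,
          map_zero]
        exact Submodule.zero_mem _
  | zero => simp
  | add s t _ _ hs ht =>
    have := Submodule.add_mem _ (hs ξ η) (ht ξ η)
    rwa [← map_add] at this
  | neg t _ ht =>
    have := Submodule.neg_mem _ (ht ξ η)
    rwa [← map_neg] at this
  | left_absorb a t _ ht =>
    exact X.fockInner_apply_mem hJ (fun ξ => ht ξ η) a.2 ξ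
  | right_absorb a t _ ht => exact ht ξ (a.1 η)

end Toeplitz

/-! ### Both directions for the gauge action. -/

section Free

/-- The part of a vector of the Fock module of degree `-1` modulo `k` has its inner products
in `I_{k-1}`. -/
theorem fockInner_sum_gaugeUnitary_mem (k : ℕ) [NeZero k] (ξ : X.PreFock) (η : X.Fock) :
    X.fockInner ξ (∑ j : ZMod k, (ZMod.toCircle j : ℂ) • X.gaugeUnitary (ZMod.toCircle j) η) ∈
      X.innerIdeal (k - 1) := by
  obtain ⟨Q, hQ⟩ : ∃ Q : X.Fock →L[ℂ] X.Fock, ∀ η, Q η =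
      ∑ j : ZMod k, (ZMod.toCircle j : ℂ) • X.gaugeUnitary (ZMod.toCircle j) η :=
    ⟨∑ j : ZMod k, (ZMod.toCircle j : ℂ) • X.gaugeUnitary (ZMod.toCircle j),
      fun η => sum_apply _ _ _⟩
  rw [← hQ]
  refine X.fock_induction (p := fun η => X.fockInner ξ (Q η) ∈ X.innerIdeal (k - 1)) ?_ ?_ ?_ ?_ η
  · exact (X.isClosed_innerIdeal _).preimage ((X.fockInner ξ).continuous.comp Q.continuous)
  · rw [map_zero, map_zero]
    exact Submodule.zero_mem _
  · intro η η' h h'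
    rw [map_add, map_add]
    exact Submodule.add_mem _ h h'
  · intro w x
    rw [hQ]
    simp only [gaugeUnitary_vec, smul_smul, ← pow_succ']
    rw [← Finset.sum_smul, map_smul]
    -- The sum over j of χ(j)^(|w|+1) vanishes unless |w| is -1 modulo k; the extra 1 in the
    -- exponent is the weight χ(j) that selects degree -1.
    by_cases hw : k ∣ w.length + 1
    · refine Submodule.smul_mem _ _ (X.fockInner_vec_mem (fun v y => ?_) ξ)
      have h1 := X.wordInner_mem_innerIdeal (n := 0) (c := 1) Submodule.mem_top v w
      -- The shortest surviving words have length k - 1, and longer ones give smaller ideals.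
      have h2 : k - 1 ≤ 0 + w.length := by
        have := Nat.le_of_dvd (Nat.succ_pos _) hw
        omega
      exact X.mul_mul_mem_innerIdeal _ _ (X.innerIdeal_antitone h2 h1)
    · rw [ZMod.sum_toCircle_pow_eq_zero hw, zero_smul]
      exact Submodule.zero_mem _

/-- The vacuum expectation `t ↦ ⟨1, t 1⟩` on the Toeplitz algebra. -/
noncomputable def vacuumExpectation : X.toeplitz →ₗ[ℂ] A where
  toFun t := X.fockInner (X.word [] 1) (t.1 (X.vec [] 1))
  map_add' _ _ := map_add (X.fockInner (X.word [] 1)) _ _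
  map_smul' _ _ := map_smul (X.fockInner (X.word [] 1)) _ _

theorem continuous_vacuumExpectation : Continuous X.vacuumExpectation := by
  change Continuous fun t : X.toeplitz => X.fockInner (X.word [] 1) (t.1 (X.vec [] 1))
  fun_prop

theorem vacuumExpectation_toeplitzLeft (a : A) : X.vacuumExpectation (X.toeplitzLeft a) = a := by
  change X.fockInner (X.word [] 1) (X.left a (X.vec [] 1)) = a
  rw [left_vec_nil, fockInner_vec, preInner_word]
  simp [wordInner]

/-- The gauge unitaries fix the vacuum, so the average of the automorphisms applied to t becomes the
average of the unitaries applied to the vector t 1. The left factor s keeps inner products inside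
the closed subspace I_{k-1}. -/
theorem vacuumExpectation_mul_sum_gauge_mem (k : ℕ) [NeZero k] (s t : X.toeplitz) :
    X.vacuumExpectation (s * ∑ j : ZMod k, (ZMod.toCircle j : ℂ) •
      X.toeplitzGauge (ZMod.toCircle j) t) ∈ X.innerIdeal (k - 1) := by
  have h : (∑ j : ZMod k, (ZMod.toCircle j : ℂ) •
      X.toeplitzGauge (ZMod.toCircle j) t : X.toeplitz).1 (X.vec [] 1) =
      ∑ j : ZMod k, (ZMod.toCircle j : ℂ) •
        X.gaugeUnitary (ZMod.toCircle j) (t.1 (X.vec [] 1)) := by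
    rw [AddSubmonoidClass.coe_finsetSum, sum_apply]
    refine Finset.sum_congr rfl fun j _ => ?_
    change (ZMod.toCircle j : ℂ) • X.gaugeUnitary (ZMod.toCircle j)
      (t.1 (X.gaugeUnitary (ZMod.toCircle j)⁻¹ (X.vec [] 1))) = _
    rw [gaugeUnitary_vec, List.length_nil, pow_zero, one_smul]
  refine X.fockInner_apply_mem (X.isClosed_innerIdeal _) (η := (∑ j : ZMod k,
    (ZMod.toCircle j : ℂ) • X.toeplitzGauge (ZMod.toCircle j) t : X.toeplitz).1 (X.vec [] 1))
    (fun ξ => ?_) s.2 _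
  rw [h]
  exact X.fockInner_sum_gaugeUnitary_mem k ξ _

variable [CompleteSpace E]

instance isTopologicalRing_cuntzPimsner : IsTopologicalRing X.CuntzPimsner :=
  X.cpIdeal.isTopologicalRing_quotient

/-- The quotient map from the Toeplitz algebra to the Cuntz-Pimsner algebra. -/
noncomputable def toCuntzPimsner : X.toeplitz →ₐ[ℂ] X.CuntzPimsner := Ideal.Quotient.mkₐ ℂ X.cpIdeal

theorem isOpenQuotientMap_toCuntzPimsner : IsOpenQuotientMap X.toCuntzPimsner :=
  X.cpIdeal.isOpenQuotientMap_quotientMk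

theorem toCuntzPimsner_eq_zero_iff {t : X.toeplitz} : X.toCuntzPimsner t = 0 ↔ t ∈ X.cpIdeal :=
  Ideal.Quotient.eq_zero_iff_mem

theorem gaugeZMod_toCuntzPimsner (k : ℕ) [NeZero k] (g : Multiplicative (ZMod k))
    (t : X.toeplitz) : X.gaugeZMod k g (X.toCuntzPimsner t) =
      X.toCuntzPimsner (X.toeplitzGauge (ZMod.toCircle g.toAdd) t) := rfl

/-- The vacuum expectation is tested against the closure of J_E + I_{k-1}: elements of the
Cuntz-Pimsner ideal account for J_E, products with a right factor of degree -1 for I_{k-1}.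
Evaluating at the image of a returns a itself. -/
theorem topologicalClosure_eq_top_of_isFreeAction {k : ℕ} [NeZero k]
    (h : IsFreeAction (X.gaugeZMod k)) :
    (X.katsuraIdeal ⊔ X.innerIdeal (k - 1)).topologicalClosure = ⊤ := by
  refine eq_top_iff.mpr fun a _ => ?_
  rw [← X.vacuumExpectation_toeplitzLeft a]
  refine h.apply_mem (β := fun j => X.toeplitzGauge (ZMod.toCircle j))
    (X.gaugeZMod_toCuntzPimsner k) X.isOpenQuotientMap_toCuntzPimsner
    (Submodule.isClosed_topologicalClosure _) X.continuous_vacuumExpectation (fun t ht => ?_)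
    (fun s t => ?_) _
  · exact Submodule.topologicalClosure_mono le_sup_left
      (X.fockInner_mem_of_mem_cpIdeal (X.toCuntzPimsner_eq_zero_iff.mp ht) _ _)
  · exact Submodule.le_topologicalClosure _
      (Submodule.mem_sup_right (X.vacuumExpectation_mul_sum_gauge_mem k s t))

variable {X} {k : ℕ} [NeZero k]

/-- In T_e⋆ x T_f the left factor is free of charge and T_f contributes degree 1, so each step of
the recursion for I_n raises the exponent by one. -/
theorem toeplitzLeft_mem_coefficientSpace {n : ℕ} {x : A} (hx : x ∈ X.innerIdeal n) :
    X.toeplitzLeft x ∈ coefficientSpace (X.gaugeZMod k) X.toCuntzPimsner n := by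
  have hc (n : ℕ) := isClosed_coefficientSpace (n := n) (α := X.gaugeZMod k)
    X.isOpenQuotientMap_toCuntzPimsner.continuous
  induction n generalizing x with
  | zero => exact mem_coefficientSpace_zero _
  | succ n ih =>
    have h : X.innerIdeal (n + 1) ≤ (coefficientSpace (X.gaugeZMod k) X.toCuntzPimsner
        (n + 1)).comap X.toeplitzLeftL.toLinearMap := by
      refine X.innerIdeal_succ_le ((hc _).preimage X.toeplitzLeftL.continuous) fun e f x hx => ?_
      rw [Submodule.mem_comap, ContinuousLinearMap.coe_coe, toeplitzLeftL_apply,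
        ← toeplitzAnnihilate_mul_left_mul_create]
      refine mul_mem_coefficientSpace_add
        (β := fun j => X.toeplitzGauge (ZMod.toCircle j)) (X.gaugeZMod_toCuntzPimsner k)
        (mul_mem_coefficientSpace _ (ih hx)) fun j => ?_
      rw [toeplitzGauge_create, pow_one]
    exact h hx

/-- ψ₁(|e⟩⟨f|) = T_e T_f⋆, where T_e has a coefficient in degree 0 for trivial reasons and T_f⋆ has
degree -1, that is k - 1. -/
theorem psi_mem_coefficientSpace (T : compacts A E) :
    X.psi T ∈ coefficientSpace (X.gaugeZMod k) X.toCuntzPimsner (k - 1) := by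
  -- ψ₁ is accessible only through its closed graph, so the claim is proved for second coordinates
  -- of the graph. The image of the coefficient space among all operators is closed because T_E is.
  have h : X.psiGraph ≤ ((coefficientSpace (X.gaugeZMod k) X.toCuntzPimsner (k - 1)).map
      X.toeplitz.val.toLinearMap).comap (LinearMap.snd ℂ _ _) := by
    refine Submodule.topologicalClosure_minimal _ (Submodule.span_le.mpr ?_) ?_
    · rintro _ ⟨⟨e, f⟩, rfl⟩
      refine ⟨X.toeplitzCreate e * X.toeplitzAnnihilate f, ?_, rfl⟩
      have h1 := mul_mem_coefficientSpace_add (m := k - 1)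
        (β := fun j => X.toeplitzGauge (ZMod.toCircle j)) (X.gaugeZMod_toCuntzPimsner k)
        (mem_coefficientSpace_zero (X.toeplitzCreate e)) (s := X.toeplitzAnnihilate f)
        fun j : ZMod k => by
          rw [toeplitzGauge_annihilate, ZMod.coe_toCircle_inv_eq_pow]
      rwa [zero_add] at h1
    · exact (X.isClosed_toeplitz.isClosedEmbedding_subtypeVal.isClosedMap _
        (isClosed_coefficientSpace X.isOpenQuotientMap_toCuntzPimsner.continuous)).preimage
          continuous_snd
  obtain ⟨t, ht, hT⟩ := h (X.psi_mem_psiGraph T)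
  rwa [← show t = X.psi T from Subtype.ext hT]

/-- Membership depends only on the image in O_E, where a and ψ₁(φ(a)) coincide. This is where the
Cuntz-Pimsner relation enters. -/
theorem toeplitzLeft_mem_coefficientSpace_of_mem_katsuraIdeal {a : A} (ha : a ∈ X.katsuraIdeal) :
    X.toeplitzLeft a ∈ coefficientSpace (X.gaugeZMod k) X.toCuntzPimsner (k - 1) := by
  have h : X.toCuntzPimsner (X.toeplitzLeft a) = X.toCuntzPimsner (X.psi ⟨X.φ a, ha.1⟩) :=
    Ideal.Quotient.eq.mpr (subset_closure (TwoSidedIdeal.subset_span ⟨a, ha, rfl⟩))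
  rw [mem_coefficientSpace, h]
  exact psi_mem_coefficientSpace _

theorem isFreeAction_of_topologicalClosure_eq_top
    (h : (X.katsuraIdeal ⊔ X.innerIdeal (k - 1)).topologicalClosure = ⊤) :
    IsFreeAction (X.gaugeZMod k) := by
  have h1 : (X.katsuraIdeal ⊔ X.innerIdeal (k - 1)).topologicalClosure ≤
      (coefficientSpace (X.gaugeZMod k) X.toCuntzPimsner (k - 1)).comap
        X.toeplitzLeftL.toLinearMap :=
    Submodule.topologicalClosure_minimal _
      (sup_le (fun _ => toeplitzLeft_mem_coefficientSpace_of_mem_katsuraIdeal)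
        fun _ => toeplitzLeft_mem_coefficientSpace)
      ((isClosed_coefficientSpace X.isOpenQuotientMap_toCuntzPimsner.continuous).preimage
        X.toeplitzLeftL.continuous)
  -- Density is needed only at the unit: 1 in the coefficient space at k - 1 says that χ⁻¹ • 1 is
  -- attained.
  have h2 : X.toeplitzLeft 1 ∈ coefficientSpace (X.gaugeZMod k) X.toCuntzPimsner (k - 1) :=
    h1 (h ▸ Submodule.mem_top)
  rw [show X.toeplitzLeft 1 = 1 from Subtype.ext X.left_one, mem_coefficientSpace, map_one] at h2
  exact isFreeAction_of_generator_mem h2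

end Free

end CStarCorrespondence

theorem mainTheorem2 {A E : Type*} [CStarAlgebra A] [PartialOrder A] [StarOrderedRing A]
    [NormedAddCommGroup E] [NormedSpace ℂ E] [CompleteSpace E]
    [Module Aᵐᵒᵖ E] [CStarModule Aᵐᵒᵖ E] (X : CStarCorrespondence A E)
    (k : ℕ) [NeZero k] (hk : 2 ≤ k) :
    IsFreeAction (X.gaugeZMod k) ↔
      (X.katsuraIdeal ⊔ X.innerIdeal (k - 1)).topologicalClosure = ⊤ :=
  ⟨X.topologicalClosure_eq_top_of_isFreeAction,
    CStarCorrespondence.isFreeAction_of_topologicalClosure_eq_top⟩
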